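/- Decoupled bandit with $K\ge 2$ arms and horizon $T$. In each round $t=1,\dots,T$ an adaptive (possibly randomized) environment fixes a loss vector $\ell_t\in[0,1]^K$; the learner exploits an arm $i_t$ (suffering $\ell_{t,i_t}$ without observing it) and explores an arm $j_t$ (observing $\ell_{t,j_t}$ without suffering it). The pseudo-regret is $$\mathrm{Reg}(T)=\mathbb E\Big[\sum_{t=1}^T\ell_{t,i_t}\Big]-\min_{i\in[K]}\mathbb E\Big[\sum_{t=1}^T\ell_{t,i}\Big].$$ *Algorithm.* Given a shape $\alpha>1$ and learning rates $\eta_t>0$, set $\hat L_1=\mathbf 0$. In round $t$: draw $r_{t,1},\dots,r_{t,K}$ afresh, i.i.d. from the Pareto distribution with density $\alpha x^{-\alpha-1}$ on $[1,\infty)$; exploit $i_t\in\arg\min_{i}\{\hat L_{t,i}-r_{t,i}/\eta_t\}$; explore $j_t\sim p_t$, where $$p_{t,i}=\frac{q_{t,i}}{\sum_{k}q_{t,k}},\qquad q_{t,i}=\Big(\frac{1}{1+\eta_t(\hat L_{t,i}-\min_k\hat L_{t,k})}\wedge\frac1{\sigma_{t,i}^{1/\alpha}}\Big)^{\frac{\alpha+1}2},$$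 and $\sigma_{t,i}\in\{1,\dots,K\}$ is the rank of $\hat L_{t,i}$ among $\hat L_{t,1},\dots,\hat L_{t,K}$ in increasing order (ties broken arbitrarily); then put $\hat L_{t+1}=\hat L_t+\ell_{t,j_t}p_{t,j_t}^{-1}e_{j_t}$. *Stochastically constrained adversarial regime with a unique best arm.* The environment may react to the past, but there are fixed numbers $\Delta_{i,k}$ such that, conditionally on the history before round $t$, $\mathbb E[\ell_{t,i}-\ell_{t,k}]=\Delta_{i,k}$ for all $i,k,t$; and there is an arm $i^*$ with $\Delta_i:=\Delta_{i,i^*}>0$ for all $i\ne i^*$. Let $\Delta_{\min}=\min_{i\ne i^*}\Delta_i$. *Claim.* For every $c>0$ there is a constant $C>0$ depending only on $c$ such that, for all $K\ge2$ and all $T$, in every such environment the algorithm with $\alpha=3$ and $\eta_t=cK^{\frac1\alpha-\frac12}/\sqrt t$ satisfies $$\mathrm{Reg}(T)\le C\left(\sqrt{\frac{K}{\Delta_{\min}}\sum_{i\ne i^*}\frac1{\Delta_i}}+\frac{K}{\Delta_{\min}}\right).$$ -/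

import Mathlib

open MeasureTheory ProbabilityTheory

/-!  Rounds are indexed from `0`: index `t` is the round usually numbered `t + 1`, and a run of
horizon `T` consists of the rounds `t < T`.  Arms are the elements of `Fin K`. -/

noncomputable section

namespace DecoupledBandit

variable {K : ℕ}

/-- The loss gap `L i - min_j L j` of arm `i`. -/
def lossGap (L : Fin K → ℝ) (i : Fin K) : ℝ := L i - ⨅ j, L j

/-- `σ` ranks the arms by increasing value of `L`, ties being broken in any way: the rank of arm
`i`, in `{1, …, K}`, is `σ i + 1`. -/
def IsRanking (L : Fin K → ℝ) (σ : Equiv.Perm (Fin K)) : Prop :=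
  ∀ i j, L i < L j → σ i < σ j

/-- The unnormalized exploration weight
`q i = ((1 / (1 + η * gap i)) ∧ (1 / rank i ^ (1 / α))) ^ ((α + 1) / 2)`. -/
def exploreWeight (α η : ℝ) (L : Fin K → ℝ) (σ : Equiv.Perm (Fin K)) (i : Fin K) : ℝ :=
  (min (1 / (1 + η * lossGap L i)) (1 / (((σ i : ℕ) + 1 : ℝ) ^ (1 / α)))) ^ ((α + 1) / 2)

/-- The exploration probability `p i = q i / ∑ j, q j`. -/
def exploreProb (α η : ℝ) (L : Fin K → ℝ) (σ : Equiv.Perm (Fin K)) (i : Fin K) : ℝ :=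
  exploreWeight α η L σ i / ∑ k, exploreWeight α η L σ k

/-- The estimated cumulative losses at the beginning of round `t`, from the learning rates `η`, the
losses `ℓ`, the rankings `σ` and the explored arms `j`: they start at zero, and each round adds
the importance-weighted observed loss of the explored arm. -/
def estLoss (α : ℝ) (η : ℕ → ℝ) (ℓ : ℕ → Fin K → ℝ) (σ : ℕ → Equiv.Perm (Fin K))
    (j : ℕ → Fin K) : ℕ → Fin K → ℝ
  | 0 => 0
  | t + 1 => estLoss α η ℓ σ j t +
      Pi.single (j t) (ℓ t (j t) / exploreProb α (η t) (estLoss α η ℓ σ j t) (σ t) (j t))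

/-- The learning rate `c * K ^ (1 / α - 1 / 2) / √t` of the `t`-th round, counted from one. -/
def learningRate (α c : ℝ) (K : ℕ) (t : ℕ) : ℝ :=
  c * (K : ℝ) ^ (1 / α - 1 / 2) / √((t : ℝ) + 1)

variable {Ω : Type*} [m : MeasurableSpace Ω]

/-- A run over `T` rounds of follow-the-perturbed-leader with Pareto perturbations for decoupled
exploration and exploitation.  `ℱ t` is the history at the beginning of round `t`; `ℓ` are the
losses, `r` the perturbations, `σ` the rankings of the estimated losses, `i` the exploited arms
and `j` the explored arms.  The losses of a round may depend in any way on the history, but they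
are fixed before the learner draws the randomness of that round. -/
structure IsRun (μ : Measure Ω) (α : ℝ) (η : ℕ → ℝ) (T : ℕ) (ℱ : Filtration ℕ m)
    (ℓ r : ℕ → Ω → Fin K → ℝ) (σ : ℕ → Ω → Equiv.Perm (Fin K)) (i j : ℕ → Ω → Fin K) :
    Prop where
  /-- The losses, perturbations and arms of the earlier rounds belong to the history. -/
  measurable_loss : ∀ t < T, Measurable[ℱ (t + 1)] (ℓ t)
  measurable_perturbation : ∀ t < T, Measurable[ℱ (t + 1)] (r t)
  measurable_exploit : ∀ t < T, Measurable[ℱ (t + 1)] (i t)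
  measurable_explore : ∀ t < T, Measurable[ℱ (t + 1)] (j t)
  /-- The rankings are determined at the beginning of the round, with any tie-breaking. -/
  measurable_rank : ∀ t < T, ∀ k, Measurable[ℱ t] (fun ω => σ t ω k)
  rank : ∀ t < T, ∀ ω,
    IsRanking (estLoss α η (fun s => ℓ s ω) (fun s => σ s ω) (fun s => j s ω) t) (σ t ω)
  /-- The perturbations are drawn afresh, i.i.d. over the arms from the Pareto distribution with
  scale `1` and shape `α`. -/
  perturbation_law : ∀ t < T, μ.map (r t) = Measure.pi (fun _ => paretoMeasure 1 α)
  perturbation_indep : ∀ t < T,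
    Indep (MeasurableSpace.comap (r t) inferInstance)
      (ℱ t ⊔ MeasurableSpace.comap (ℓ t) inferInstance) μ
  /-- The exploited arm minimizes the perturbed estimated cumulative loss. -/
  exploit : ∀ t < T, ∀ ω k,
    estLoss α η (fun s => ℓ s ω) (fun s => σ s ω) (fun s => j s ω) t (i t ω) -
        r t ω (i t ω) / η t ≤
      estLoss α η (fun s => ℓ s ω) (fun s => σ s ω) (fun s => j s ω) t k - r t ω k / η t
  /-- The explored arm is drawn from the exploration distribution, given the history, the losses
  and the perturbations. -/
  explore : ∀ t < T, ∀ k,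
    μ[{ω | j t ω = k}.indicator (fun _ => (1 : ℝ)) |
        ℱ t ⊔ MeasurableSpace.comap (ℓ t) inferInstance ⊔
          MeasurableSpace.comap (r t) inferInstance]
      =ᵐ[μ] fun ω => exploreProb α (η t)
        (estLoss α η (fun s => ℓ s ω) (fun s => σ s ω) (fun s => j s ω) t) (σ t ω) k

/-- The stochastically constrained adversarial regime with respect to the history `ℱ`: the losses
lie in `[0, 1]`, and whatever happened before, the conditional expected loss of arm `k` in a round
exceeds that of arm `k'` by the fixed amount `Δ k k'`. -/
structure IsSCA (μ : Measure Ω) (T : ℕ) (ℱ : Filtration ℕ m) (ℓ : ℕ → Ω → Fin K → ℝ)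
    (Δ : Fin K → Fin K → ℝ) : Prop where
  loss_mem : ∀ t < T, ∀ ω k, ℓ t ω k ∈ Set.Icc (0 : ℝ) 1
  gap : ∀ t < T, ∀ k k',
    μ[fun ω => ℓ t ω k - ℓ t ω k' | ℱ t] =ᵐ[μ] fun _ => Δ k k'

/-- The pseudo-regret over `T` rounds of the exploited arms `i`. -/
def pseudoRegret (μ : Measure Ω) (T : ℕ) (ℓ : ℕ → Ω → Fin K → ℝ) (i : ℕ → Ω → Fin K) : ℝ :=
  (∫ ω, ∑ t ∈ Finset.range T, ℓ t ω (i t ω) ∂μ) -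
    ⨅ k, ∫ ω, ∑ t ∈ Finset.range T, ℓ t ω k ∂μ

/-- The smallest suboptimality gap `min_{k ≠ k₀} Δ k k₀`. -/
def minGap (Δ : Fin K → Fin K → ℝ) (k₀ : Fin K) : ℝ := ⨅ k : {k : Fin K // k ≠ k₀}, Δ k k₀

end DecoupledBandit

end

/-! The leader perturbed with `ρ / η` is the minimizer in the potential
`Φ β L = E[min_i (L i - β * (ρ i - ρ b))]` at `β = 1 / η`. Raising the loss estimate of the explored
arm raises the potential at least by the loss of the leader chosen after the update, and
`Φ 0 0 = 0` while `Φ β L ≤ L b`. So each round costs at most two terms: the stability term compares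
the leaders before and after the update, and the penalty is the increase of `β` times the expected
excess of the winning perturbation over that of `b`. This excess vanishes when `b` wins and,
truncated at the level `M`, is at most `M` times the probability that `b` loses plus a Pareto tail.
For `α = 3` the stability term has a bound of the same shape with the same exponent of `M`, so for
large `t` the level `M` can be chosen such that the round costs at most half of the regret it
causes, which is at least the gap times the probability that `b` loses, plus a term of order
`t ^ (-3 / 2)`. In the rounds before, the worst-case costs of order `K ^ (1 / 2) / √t` suffice. -/

noncomputable section

namespace DecoupledBandit

open scoped Finset

section Pareto

variable {t α : ℝ}

instance : NullSingletonClass (paretoMeasure t α) := by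
  unfold paretoMeasure; infer_instance

lemma ae_le_paretoMeasure (t α : ℝ) : ∀ᵐ x ∂paretoMeasure t α, t ≤ x := by
  have h : {x : ℝ | ¬ t ≤ x} = Set.Iio t := by ext; simp
  rw [ae_iff, h, paretoMeasure, withDensity_apply _ measurableSet_Iio]
  exact lintegral_paretoPDF_of_le le_rfl

lemma paretoMeasure_real_eq_setIntegral (ht : 0 ≤ t) (hα : 0 ≤ α) {s : Set ℝ}
    (hs : MeasurableSet s) : (paretoMeasure t α).real s = ∫ x in s, paretoPDFReal t α x := by
  rw [measureReal_def, paretoMeasure, withDensity_apply _ hs,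
    integral_eq_lintegral_of_nonneg_ae (ae_of_all _ (paretoPDFReal_nonneg ht hα)) (by fun_prop)]
  rfl

lemma paretoMeasure_real_Ici_of_le (ht : 0 < t) (hα : 0 < α) {z : ℝ} (hz : t ≤ z) :
    (paretoMeasure t α).real (Set.Ici z) = t ^ α * z ^ (-α) := by
  rw [paretoMeasure_real_eq_setIntegral ht.le hα.le measurableSet_Ici,
    setIntegral_congr_fun (g := fun x => α * t ^ α * x ^ (-(α + 1))) measurableSet_Ici
      (fun x hx => by rw [paretoPDFReal, if_pos (hz.trans hx)]),
    integral_Ici_eq_integral_Ioi, integral_const_mul,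
    integral_Ioi_rpow_of_lt (by linarith) (ht.trans_le hz), neg_add, neg_add_cancel_right]
  field_simp

lemma paretoMeasure_real_Ici (ht : 0 < t) (hα : 0 < α) (z : ℝ) :
    (paretoMeasure t α).real (Set.Ici z) = t ^ α * max t z ^ (-α) := by
  rcases le_total t z with h | h
  · rw [max_eq_right h, paretoMeasure_real_Ici_of_le ht hα h]
  · rw [max_eq_left h, ← paretoMeasure_real_Ici_of_le ht hα le_rfl]
    refine measureReal_congr ?_
    filter_upwards [ae_le_paretoMeasure t α] with x hx
    exact propext ⟨fun _ => hx, fun _ => h.trans hx⟩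

lemma paretoPDFReal_le (ht : 0 < t) (hα : 0 ≤ α) {x z : ℝ} (hz : z ≤ x) :
    paretoPDFReal t α x ≤ α * t ^ α * max t z ^ (-(α + 1)) := by
  have hmax : 0 < max t z := lt_max_of_lt_left ht
  unfold paretoPDFReal
  split_ifs with htx
  · exact mul_le_mul_of_nonneg_left
      (Real.rpow_le_rpow_of_nonpos hmax (max_le htx hz) (by linarith)) (by positivity)
  · positivity

lemma paretoMeasure_real_Ico_le (ht : 0 < t) (hα : 0 ≤ α) (z : ℝ) {δ : ℝ} (hδ : 0 ≤ δ) :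
    (paretoMeasure t α).real (Set.Ico z (z + δ)) ≤ α * t ^ α * max t z ^ (-(α + 1)) * δ := by
  have hbound : ∀ x ∈ Set.Ico z (z + δ),
      ‖paretoPDFReal t α x‖ ≤ α * t ^ α * max t z ^ (-(α + 1)) := fun x hx => by
    rw [Real.norm_of_nonneg (paretoPDFReal_nonneg ht.le hα x)]
    exact paretoPDFReal_le ht hα hx.1
  rw [paretoMeasure_real_eq_setIntegral ht.le hα measurableSet_Ico]
  refine (le_abs_self _).trans ((norm_setIntegral_le_of_norm_le_const (by simp) hbound).trans ?_)
  simp [hδ]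

lemma toReal_paretoPDF_smul (ht : 0 < t) (hα : 0 ≤ α) {x : ℝ} (hx : t ≤ x) :
    (paretoPDF t α x).toReal • x = α * t ^ α * x ^ (-α) := by
  rw [paretoPDF, ENNReal.toReal_ofReal (paretoPDFReal_nonneg ht.le hα x), paretoPDFReal,
    if_pos hx, smul_eq_mul, mul_assoc, ← Real.rpow_add_one (ht.trans_le hx).ne', neg_add,
    neg_add_cancel_right]

lemma measurable_paretoPDF (t α : ℝ) : Measurable (paretoPDF t α) := by
  unfold paretoPDF; fun_prop

lemma paretoPDF_lt_top (t α x : ℝ) : paretoPDF t α x < ⊤ := ENNReal.ofReal_lt_top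

lemma integrableOn_id_paretoMeasure (ht : 0 < t) (hα : 1 < α) :
    IntegrableOn id (Set.Ioi t) (paretoMeasure t α) := by
  rw [IntegrableOn, paretoMeasure, restrict_withDensity measurableSet_Ioi,
    integrable_withDensity_iff_integrable_smul' (measurable_paretoPDF t α)
      (ae_of_all _ (paretoPDF_lt_top t α))]
  refine Integrable.congr ((integrableOn_Ioi_rpow_of_lt (a := -α) (by linarith) ht).const_mul
    (α * t ^ α)) ?_
  filter_upwards [ae_restrict_mem measurableSet_Ioi] with x hx
  exact (toReal_paretoPDF_smul ht (by linarith) (le_of_lt hx)).symm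

lemma setIntegral_id_paretoMeasure (ht : 0 < t) (hα : 1 < α) {M : ℝ} (hM : t ≤ M) :
    ∫ x in Set.Ioi M, x ∂paretoMeasure t α = α / (α - 1) * t ^ α * M ^ (1 - α) := by
  rw [paretoMeasure, restrict_withDensity measurableSet_Ioi,
    integral_withDensity_eq_integral_toReal_smul (measurable_paretoPDF t α)
      (ae_of_all _ (paretoPDF_lt_top t α)),
    setIntegral_congr_fun measurableSet_Ioi
      (fun x hx => toReal_paretoPDF_smul ht (by linarith) (hM.trans (le_of_lt hx))),
    integral_const_mul, integral_Ioi_rpow_of_lt (by linarith) (ht.trans_le hM),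
    show -α + 1 = 1 - α by ring, show 1 - α = -(α - 1) by ring, neg_div_neg_eq]
  ring

lemma integrable_id_paretoMeasure (ht : 0 < t) (hα : 1 < α) :
    Integrable id (paretoMeasure t α) := by
  have := isProbabilityMeasure_paretoMeasure ht (zero_lt_one.trans hα)
  rw [← integrableOn_univ, ← Set.Iic_union_Ioi (a := t)]
  refine IntegrableOn.union ?_ (integrableOn_id_paretoMeasure ht hα)
  refine Measure.integrableOn_of_bounded (M := t) (measure_ne_top _ _) (by fun_prop) ?_
  filter_upwards [ae_restrict_mem measurableSet_Iic,
    ae_restrict_of_ae (ae_le_paretoMeasure t α)] with x hxt htx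
  rwa [id, Real.norm_of_nonneg (ht.le.trans htx)]

lemma paretoMeasure_real_Iio (hα : 0 < α) {z : ℝ} (hz : 1 ≤ z) :
    (paretoMeasure 1 α).real (Set.Iio z) = 1 - z ^ (-α) := by
  have := isProbabilityMeasure_paretoMeasure one_pos hα
  rw [← Set.compl_Ici, probReal_compl_eq_one_sub measurableSet_Ici,
    paretoMeasure_real_Ici_of_le one_pos hα hz, Real.one_rpow, one_mul]

lemma paretoMeasure_real_lt_rpow_neg_le (hα : 0 < α) {u : ℝ} (hu : u ∈ Set.Ioo (0 : ℝ) 1) :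
    (paretoMeasure 1 α).real {y | u < y ^ (-α)} ≤ 1 - u := by
  have := isProbabilityMeasure_paretoMeasure one_pos hα
  have hu' : 1 ≤ u ^ (-α⁻¹) :=
    Real.one_le_rpow_of_pos_of_le_one_of_nonpos hu.1 hu.2.le (by simpa using hα.le)
  have hpow : (u ^ (-α⁻¹)) ^ (-α) = u := by
    rw [← Real.rpow_mul hu.1.le, neg_mul_neg, inv_mul_cancel₀ hα.ne', Real.rpow_one]
  have hsub : {y : ℝ | u < y ^ (-α)} ⊆ Set.Iio (u ^ (-α⁻¹)) := fun y hy => by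
    contrapose! hy
    exact not_lt.2 <|
      (Real.rpow_le_rpow_of_nonpos (by linarith) (not_lt.1 hy) (by linarith)).trans_eq hpow
  exact (measureReal_mono hsub).trans_eq (by rw [paretoMeasure_real_Iio hα hu', hpow])

lemma paretoMeasure_real_Ico_le_mul (hα : 0 ≤ α) (z : ℝ) {δ : ℝ} (hδ : 0 ≤ δ) :
    (paretoMeasure 1 α).real (Set.Ico z (z + δ)) ≤ α * δ :=
  calc _ ≤ α * 1 ^ α * max 1 z ^ (-(α + 1)) * δ := paretoMeasure_real_Ico_le one_pos hα z hδ
    _ ≤ α * 1 ^ α * 1 * δ := by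
        gcongr
        exact Real.rpow_le_one_of_one_le_of_nonpos (le_max_left _ _) (by linarith)
    _ = α * δ := by rw [Real.one_rpow, mul_one, mul_one]

lemma paretoMeasure_real_Ico_eq_zero {a b : ℝ} (hb : b ≤ t) :
    (paretoMeasure t α).real (Set.Ico a b) = 0 := by
  rw [measureReal_def, measure_mono_null (fun y hy => ?_) (ae_iff.1 (ae_le_paretoMeasure t α)),
    ENNReal.toReal_zero]
  exact not_le.2 (hy.2.trans_le hb)

end Pareto

section Resampling

variable {ι : Type*} [Fintype ι] [DecidableEq ι] {X : ι → Type*} [∀ k, MeasurableSpace (X k)]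
  (μ : ∀ k, Measure (X k)) [∀ k, IsProbabilityMeasure (μ k)]

lemma lintegral_pi_eq_lintegral_lintegral_update (k : ι) {f : (∀ k, X k) → ENNReal}
    (hf : Measurable f) :
    ∫⁻ x, f x ∂Measure.pi μ = ∫⁻ x, ∫⁻ y, f (Function.update x k y) ∂μ k ∂Measure.pi μ := by
  simp_rw [← lmarginal_singleton]
  refine lintegral_eq_of_lmarginal_eq {k} hf (hf.lmarginal μ) ?_
  ext x
  simp [lmarginal_singleton]

lemma pi_real_eq_integral_real_update (k : ι) {A : Set (∀ k, X k)} (hA : MeasurableSet A) :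
    (Measure.pi μ).real A =
      ∫ x, (μ k).real {y | Function.update x k y ∈ A} ∂Measure.pi μ := by
  have hfiber : ∀ x : ∀ k, X k, ∫⁻ y, A.indicator 1 (Function.update x k y) ∂μ k =
      μ k {y | Function.update x k y ∈ A} := fun x =>
    lintegral_indicator_one (hA.preimage (measurable_update x))
  have hmeas : Measurable fun x : ∀ k, X k => μ k {y | Function.update x k y ∈ A} := by
    have := (measurable_one.indicator hA).lmarginal (s := {k}) μ
    simpa only [lmarginal_singleton, hfiber] using this
  rw [measureReal_def, ← lintegral_indicator_one hA,
    lintegral_pi_eq_lintegral_lintegral_update μ k (measurable_one.indicator hA)]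
  simp_rw [hfiber]
  exact (integral_toReal hmeas.aemeasurable (ae_of_all _ fun _ => measure_lt_top _ _)).symm

end Resampling

section PerturbedLeader

variable {ι : Type*}

/-- The perturbations for which arm `k` maximizes the perturbed value `ρ k - g k`. -/
def winSet (g : ι → ℝ) (k : ι) : Set (ι → ℝ) := {ρ | ∀ j, ρ j - g j ≤ ρ k - g k}

/-- The probability that arm `k` maximizes `ρ k - g k` when the perturbation `ρ` has law `P`. -/
def winProb (P : Measure (ι → ℝ)) (g : ι → ℝ) (k : ι) : ℝ := P.real (winSet g k)

/-- The expected minimum over the arms `i` of `L i - β * ρ i` for a perturbation `ρ` of law `P`;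
adding the perturbation of a fixed arm `b` makes it comparable with the loss of `b`. -/
def potential (P : Measure (ι → ℝ)) (b : ι) (β : ℝ) (L : ι → ℝ) : ℝ :=
  ∫ ρ, ⨅ i, (L i - β * (ρ i - ρ b)) ∂P

lemma measurableSet_mem_winSet [Countable ι] (k : ι) :
    MeasurableSet {p : (ι → ℝ) × (ι → ℝ) | p.2 ∈ winSet p.1 k} := by
  have h : {p : (ι → ℝ) × (ι → ℝ) | p.2 ∈ winSet p.1 k} =
      ⋂ j, {p | p.2 j - p.1 j ≤ p.2 k - p.1 k} := by ext; simp [winSet]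
  rw [h]
  exact MeasurableSet.iInter fun j => measurableSet_le (by fun_prop) (by fun_prop)

lemma measurableSet_winSet [Countable ι] (g : ι → ℝ) (k : ι) : MeasurableSet (winSet g k) :=
  measurable_prodMk_left (measurableSet_mem_winSet k)

lemma exists_mem_winSet [Finite ι] [Nonempty ι] (g ρ : ι → ℝ) : ∃ k, ρ ∈ winSet g k :=
  Finite.exists_max fun j => ρ j - g j

lemma winSet_sub_const (g : ι → ℝ) (a : ℝ) (k : ι) :
    winSet (fun j => g j - a) k = winSet g k := by
  ext ρ
  exact forall_congr' fun j => by constructor <;> intro h <;> linarith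

lemma winSet_add_single_subset [DecidableEq ι] (g : ι → ℝ) (k : ι) {δ : ℝ} (hδ : 0 ≤ δ) :
    winSet (g + Pi.single k δ) k ⊆ winSet g k := fun ρ h j => by
  obtain rfl | hj := eq_or_ne j k
  · exact le_rfl
  · have := h j
    simp only [Pi.add_apply, Pi.single_eq_same, Pi.single_eq_of_ne hj] at this
    linarith

lemma mem_winSet_smul_iff {η : ℝ} (hη : 0 < η) (L ρ : ι → ℝ) (k : ι) :
    ρ ∈ winSet (η • L) k ↔ ∀ j, L k - ρ k / η ≤ L j - ρ j / η := by
  have h : ∀ i, ρ i - (η • L) i = -η * (L i - ρ i / η) := fun i => by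
    simp only [Pi.smul_apply, smul_eq_mul]; field_simp; ring
  simp only [winSet, Set.mem_ofPred_eq, h, mul_le_mul_left_of_neg (neg_neg_of_pos hη)]

section WinProb

variable {P : Measure (ι → ℝ)}

lemma measurable_winProb [Countable ι] [SFinite P] (k : ι) :
    Measurable fun g : ι → ℝ => winProb P g k :=
  (measurable_measure_prodMk_left (measurableSet_mem_winSet k)).ennreal_toReal

lemma winProb_nonneg (g : ι → ℝ) (k : ι) : 0 ≤ winProb P g k := measureReal_nonneg

lemma winProb_le_one [IsProbabilityMeasure P] (g : ι → ℝ) (k : ι) : winProb P g k ≤ 1 :=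
  measureReal_le_one

lemma winProb_sub_const (g : ι → ℝ) (a : ℝ) (k : ι) :
    winProb P (fun j => g j - a) k = winProb P g k := by
  rw [winProb, winSet_sub_const, winProb]

lemma winProb_add_single_le [DecidableEq ι] [IsFiniteMeasure P] (g : ι → ℝ) (k : ι) {δ : ℝ}
    (hδ : 0 ≤ δ) : winProb P (g + Pi.single k δ) k ≤ winProb P g k :=
  measureReal_mono (winSet_add_single_subset g k hδ)

end WinProb

section Product

variable [Fintype ι] (ν : ι → Measure ℝ) [∀ k, IsProbabilityMeasure (ν k)]

lemma winSet_inter_null [∀ k, NullSingletonClass (ν k)] (g : ι → ℝ) {k k' : ι} (h : k ≠ k') :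
    Measure.pi ν (winSet g k ∩ winSet g k') = 0 := by
  classical
  have hsub : winSet g k ∩ winSet g k' ⊆ {ρ | ρ k - g k = ρ k' - g k'} := fun ρ hρ =>
    le_antisymm (hρ.2 k) (hρ.1 k')
  have hmeas : MeasurableSet {ρ : ι → ℝ | ρ k - g k = ρ k' - g k'} :=
    measurableSet_eq_fun (by fun_prop) (by fun_prop)
  refine measure_mono_null hsub ((measureReal_eq_zero_iff (measure_ne_top _ _)).1 ?_)
  have hfiber : ∀ x : ι → ℝ,
      {y | Function.update x k y ∈ {ρ : ι → ℝ | ρ k - g k = ρ k' - g k'}} =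
        {x k' - g k' + g k} := fun x => by
    ext y
    simp [Function.update_of_ne h.symm, sub_eq_iff_eq_add]
  simp only [pi_real_eq_integral_real_update ν k hmeas, hfiber, measureReal_def, measure_singleton,
    ENNReal.toReal_zero, integral_zero]

/- Given the other perturbations, arm `k` wins exactly when its own one reaches a critical value
`z`, and raising `g k` by `δ` moves this value to `z + δ`. -/
lemma winProb_sub_le_integral [Nontrivial ι] [DecidableEq ι] (g : ι → ℝ) (k : ι) {δ : ℝ}
    (hδ : 0 ≤ δ) {G : (ι → ℝ) → ℝ} (hG : Integrable G (Measure.pi ν))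
    (h : ∀ᵐ x ∂Measure.pi ν, ∀ z, IsGreatest ((fun j => x j - g j + g k) '' {k}ᶜ) z →
      (ν k).real (Set.Ico z (z + δ)) ≤ G x) :
    winProb (Measure.pi ν) g k - winProb (Measure.pi ν) (g + Pi.single k δ) k ≤
      ∫ x, G x ∂Measure.pi ν := by
  have hmeas := measurableSet_winSet g k
  have hmeas' := measurableSet_winSet (g + Pi.single k δ) k
  rw [winProb, winProb, ← measureReal_sdiff (winSet_add_single_subset g k hδ) hmeas',
    pi_real_eq_integral_real_update ν k (hmeas.diff hmeas')]
  refine integral_mono_of_nonneg (ae_of_all _ fun x => measureReal_nonneg) hG ?_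
  filter_upwards [h] with x hx
  obtain ⟨j, hj, hmax⟩ := Set.exists_max_image ({k}ᶜ : Set ι) (fun j => x j - g j + g k)
    (Set.toFinite _) (exists_ne k)
  refine (measureReal_mono ?_).trans
    (hx _ ⟨Set.mem_image_of_mem _ hj, Set.forall_mem_image.2 hmax⟩)
  rintro y ⟨hwin, hlose⟩
  constructor
  · have := hwin j
    simp only [Function.update_self, Function.update_of_ne hj] at this
    linarith
  · contrapose! hlose
    intro i
    obtain rfl | hi := eq_or_ne i k
    · exact le_rfl
    · have := hmax i hi
      simp only [Function.update_self, Function.update_of_ne hi, Pi.add_apply, Pi.single_eq_same,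
        Pi.single_eq_of_ne hi]
      linarith

end Product

section Potential

lemma potential_zero (P : Measure (ι → ℝ)) (b : ι) : potential P b 0 0 = 0 := by
  have : Nonempty ι := ⟨b⟩
  simp [potential]

section Finite

variable [Finite ι]

lemma ciInf_le_of_finite (f : ι → ℝ) (i : ι) : ⨅ j, f j ≤ f i :=
  ciInf_le (Set.finite_range f).bddBelow i

lemma ciInf_eq_of_mem_winSet {η : ℝ} (hη : 0 < η) {L ρ : ι → ℝ} {k : ι}
    (h : ρ ∈ winSet (η • L) k) (b : ι) :
    ⨅ i, (L i - η⁻¹ * (ρ i - ρ b)) = L k - η⁻¹ * (ρ k - ρ b) := by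
  have : Nonempty ι := ⟨b⟩
  refine le_antisymm (ciInf_le_of_finite _ k) (le_ciInf fun j => ?_)
  have := (mem_winSet_smul_iff hη L ρ k).1 h j
  simp only [div_eq_inv_mul] at this
  linarith

lemma ciInf_sub_ciInf_le_of_mem_winSet {η : ℝ} (hη : 0 < η) (β : ℝ) {L ρ : ι → ℝ} {k : ι}
    (h : ρ ∈ winSet (η • L) k) (b : ι) :
    (⨅ i, (L i - β * (ρ i - ρ b))) - ⨅ i, (L i - η⁻¹ * (ρ i - ρ b)) ≤
      (η⁻¹ - β) * (ρ k - ρ b) := by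
  have := ciInf_le_of_finite (fun i => L i - β * (ρ i - ρ b)) k
  rw [ciInf_eq_of_mem_winSet hη h b]
  linarith

variable {P : Measure (ι → ℝ)} [IsProbabilityMeasure P]

lemma integrable_ciInf_sub_mul (hP : ∀ k, Integrable (fun ρ => ρ k) P) (b : ι) (β : ℝ)
    (L : ι → ℝ) : Integrable (fun ρ : ι → ℝ => ⨅ i, (L i - β * (ρ i - ρ b))) P := by
  have : Nonempty ι := ⟨b⟩
  cases nonempty_fintype ι
  have hint : ∀ i ∈ Finset.univ, Integrable (fun ρ : ι → ℝ => ‖L i - β * (ρ i - ρ b)‖) P :=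
    fun i _ => ((integrable_const _).sub (((hP i).sub (hP b)).const_mul β)).norm
  refine (integrable_finsetSum Finset.univ hint).mono'
    (Measurable.iInf fun i => by fun_prop).aestronglyMeasurable (ae_of_all _ fun ρ => ?_)
  obtain ⟨i, hi⟩ := exists_eq_ciInf_of_finite (f := fun i => L i - β * (ρ i - ρ b))
  rw [← hi]
  exact Finset.single_le_sum (f := fun i => ‖L i - β * (ρ i - ρ b)‖)
    (fun _ _ => norm_nonneg _) (Finset.mem_univ i)

lemma potential_le (hP : ∀ k, Integrable (fun ρ => ρ k) P) (b : ι) (β : ℝ) (L : ι → ℝ) :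
    potential P b β L ≤ L b := by
  calc potential P b β L ≤ ∫ _, L b ∂P :=
        integral_mono (integrable_ciInf_sub_mul hP b β L) (integrable_const _) fun ρ =>
          (ciInf_le_of_finite _ b).trans (by simp)
    _ = L b := by simp

lemma mul_winProb_le_potential_sub [DecidableEq ι] (hP : ∀ k, Integrable (fun ρ => ρ k) P)
    (b j : ι) {η v : ℝ} (hη : 0 < η) (hv : 0 ≤ v) (L : ι → ℝ) :
    v * winProb P (η • (L + Pi.single j v)) j ≤
      potential P b η⁻¹ (L + Pi.single j v) - potential P b η⁻¹ L := by
  have : Nonempty ι := ⟨b⟩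
  have hmeas := measurableSet_winSet (η • (L + Pi.single j v)) j
  have hprob : v * winProb P (η • (L + Pi.single j v)) j =
      ∫ ρ, (winSet (η • (L + Pi.single j v)) j).indicator (fun _ => v) ρ ∂P := by
    rw [integral_indicator_const v hmeas, winProb, smul_eq_mul, mul_comm]
  rw [potential, potential, hprob, ← integral_sub (integrable_ciInf_sub_mul hP _ _ _)
    (integrable_ciInf_sub_mul hP _ _ _)]
  refine integral_mono ((integrable_const v).indicator hmeas)
    ((integrable_ciInf_sub_mul hP _ _ _).sub (integrable_ciInf_sub_mul hP _ _ _)) fun ρ => ?_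
  by_cases hρ : ρ ∈ winSet (η • (L + Pi.single j v)) j
  · have := ciInf_le_of_finite (fun i => L i - η⁻¹ * (ρ i - ρ b)) j
    rw [Set.indicator_of_mem hρ, ciInf_eq_of_mem_winSet hη hρ b]
    simp only [Pi.add_apply, Pi.single_eq_same]
    linarith
  · rw [Set.indicator_of_notMem hρ, sub_nonneg]
    refine le_ciInf fun i => (ciInf_le_of_finite _ i).trans ?_
    have : 0 ≤ (Pi.single j v : ι → ℝ) i := Pi.single_nonneg (α := fun _ => ℝ).2 hv i
    simp only [Pi.add_apply]
    linarith

end Finite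

variable [Fintype ι]

/- The excess of the winner's perturbation over that of `b` matters only when `b` loses, and up to
its tail the winner's perturbation is at most `M`. -/
lemma ciInf_sub_ciInf_le (b : ι) {η β M : ℝ} (hη : 0 < η) (hβ : β ≤ η⁻¹) (hM : 0 ≤ M)
    (L : ι → ℝ) {ρ : ι → ℝ} (hρ : ∀ k, 0 ≤ ρ k) :
    (⨅ i, (L i - β * (ρ i - ρ b))) - ⨅ i, (L i - η⁻¹ * (ρ i - ρ b)) ≤
      (η⁻¹ - β) * ((winSet (η • L) b)ᶜ.indicator (fun _ => M) ρ +
        ∑ k, {ρ : ι → ℝ | M < ρ k}.indicator (fun ρ => ρ k) ρ) := by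
  have : Nonempty ι := ⟨b⟩
  have htail : ∀ k ∈ Finset.univ, 0 ≤ {ρ : ι → ℝ | M < ρ k}.indicator (fun ρ => ρ k) ρ :=
    fun k _ => Set.indicator_apply_nonneg fun _ => hρ k
  by_cases hb : ρ ∈ winSet (η • L) b
  · refine (ciInf_sub_ciInf_le_of_mem_winSet hη β hb b).trans ?_
    rw [Set.indicator_of_notMem (Set.notMem_compl_iff.2 hb), sub_self, mul_zero, zero_add]
    exact mul_nonneg (sub_nonneg.2 hβ) (Finset.sum_nonneg htail)
  · obtain ⟨k, hk⟩ := exists_mem_winSet (η • L) ρ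
    refine (ciInf_sub_ciInf_le_of_mem_winSet hη β hk b).trans
      (mul_le_mul_of_nonneg_left ?_ (sub_nonneg.2 hβ))
    have hsplit : ρ k ≤ M + {ρ : ι → ℝ | M < ρ k}.indicator (fun ρ => ρ k) ρ := by
      by_cases h : M < ρ k
      · rw [Set.indicator_of_mem (s := {ρ : ι → ℝ | M < ρ k}) h]; linarith
      · rw [Set.indicator_of_notMem (s := {ρ : ι → ℝ | M < ρ k}) h]; linarith
    rw [Set.indicator_of_mem (s := (winSet (η • L) b)ᶜ) hb]
    linarith [hρ b, Finset.single_le_sum htail (Finset.mem_univ k)]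

lemma potential_sub_le {P : Measure (ι → ℝ)} [IsProbabilityMeasure P]
    (hP : ∀ k, Integrable (fun ρ => ρ k) P) (hP0 : ∀ᵐ ρ ∂P, ∀ k, 0 ≤ ρ k) (b : ι)
    {η β M : ℝ} (hη : 0 < η) (hβ : β ≤ η⁻¹) (hM : 0 ≤ M) (L : ι → ℝ) :
    potential P b β L - potential P b η⁻¹ L ≤
      (η⁻¹ - β) * (M * (1 - winProb P (η • L) b) + ∑ k, ∫ ρ in {ρ | M < ρ k}, ρ k ∂P) := by
  have hwin := (measurableSet_winSet (η • L) b).compl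
  have htail : ∀ k : ι, MeasurableSet {ρ : ι → ℝ | M < ρ k} := fun k =>
    measurableSet_lt measurable_const (measurable_pi_apply k)
  have hint₁ : Integrable ((winSet (η • L) b)ᶜ.indicator fun _ => M) P :=
    (integrable_const M).indicator hwin
  have hint₂ : ∀ k ∈ Finset.univ,
      Integrable ({ρ : ι → ℝ | M < ρ k}.indicator fun ρ => ρ k) P :=
    fun k _ => (hP k).indicator (htail k)
  rw [potential, potential, ← integral_sub (integrable_ciInf_sub_mul hP _ _ _)
    (integrable_ciInf_sub_mul hP _ _ _)]
  calc _ ≤ ∫ ρ, (η⁻¹ - β) * ((winSet (η • L) b)ᶜ.indicator (fun _ => M) ρ +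
          ∑ k, {ρ : ι → ℝ | M < ρ k}.indicator (fun ρ => ρ k) ρ) ∂P := by
        refine integral_mono_ae ((integrable_ciInf_sub_mul hP _ _ _).sub
          (integrable_ciInf_sub_mul hP _ _ _))
          ((hint₁.add (integrable_finsetSum _ hint₂)).const_mul _) ?_
        filter_upwards [hP0] with ρ hρ using ciInf_sub_ciInf_le b hη hβ hM L hρ
    _ = _ := by
        rw [integral_const_mul, integral_add hint₁ (integrable_finsetSum _ hint₂),
          integral_finsetSum _ hint₂, integral_indicator_const M hwin,
          probReal_compl_eq_one_sub (measurableSet_winSet _ _), smul_eq_mul, mul_comm _ M, winProb]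
        simp only [integral_indicator (htail _)]

end Potential

end PerturbedLeader

section SecondMoment

lemma integral_one_sub_pow_mul (n : ℕ) :
    ∫ u in (0 : ℝ)..1, (1 - u) ^ n * u = 1 / ((n + 1) * (n + 2)) := by
  have hreflect := intervalIntegral.integral_comp_sub_left
    (fun v : ℝ => v ^ n * (1 - v)) (a := 0) (b := 1) 1
  simp only [sub_sub_cancel, sub_self, sub_zero] at hreflect
  have hexpand : ∀ v : ℝ, v ^ n * (1 - v) = v ^ n - v ^ (n + 1) := fun v => by ring
  simp only [hreflect, hexpand]
  rw [intervalIntegral.integral_sub (by simp) (by simp), integral_pow, integral_pow]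
  simp
  field_simp
  ring

lemma integral_sq_le_of_tail_le {Ω : Type*} [MeasurableSpace Ω] {μ : Measure Ω}
    [IsFiniteMeasure μ] {W : Ω → ℝ} (hW : Measurable W) (hW0 : 0 ≤ᵐ[μ] W) (hW1 : ∀ ω, W ω ≤ 1)
    (n : ℕ) (htail : ∀ u ∈ Set.Ioo (0 : ℝ) 1, μ.real {ω | u < W ω} ≤ (1 - u) ^ n) :
    ∫ ω, W ω ^ 2 ∂μ ≤ 2 / ((n + 1) * (n + 2)) := by
  have hcake : ∫⁻ ω, ENNReal.ofReal (W ω ^ 2) ∂μ =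
      ENNReal.ofReal 2 * ∫⁻ u in Set.Ioi 0, μ {ω | u < W ω} * ENNReal.ofReal u := by
    simpa only [Real.rpow_two, show (2 : ℝ) - 1 = 1 by norm_num, Real.rpow_one] using
      lintegral_rpow_eq_lintegral_meas_lt_mul μ hW0 hW.aemeasurable two_pos
  have hbound : ∀ u ∈ Set.Ioi (0 : ℝ), μ {ω | u < W ω} * ENNReal.ofReal u ≤
      (Set.Ioo 0 1).indicator (fun u => ENNReal.ofReal ((1 - u) ^ n * u)) u := fun u hu => by
    rcases lt_or_ge u 1 with hu1 | hu1
    · rw [Set.indicator_of_mem (show u ∈ Set.Ioo 0 1 from ⟨hu, hu1⟩),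
        ENNReal.ofReal_mul (pow_nonneg (sub_nonneg.2 hu1.le) n), ← ofReal_measureReal]
      gcongr
      exact htail u ⟨hu, hu1⟩
    · have : {ω | u < W ω} = ∅ := Set.eq_empty_of_forall_notMem fun ω => ((hW1 ω).trans hu1).not_gt
      simp [this]
  have hbeta : ∫⁻ u in Set.Ioo (0 : ℝ) 1, ENNReal.ofReal ((1 - u) ^ n * u) =
      ENNReal.ofReal (1 / ((n + 1) * (n + 2))) := by
    rw [← integral_one_sub_pow_mul, intervalIntegral.integral_of_le zero_le_one,
      integral_Ioc_eq_integral_Ioo, ofReal_integral_eq_lintegral_ofReal]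
    · exact (Continuous.integrableOn_Icc (by fun_prop)).mono_set Set.Ioo_subset_Icc_self
    · filter_upwards [ae_restrict_mem measurableSet_Ioo] with u hu
      exact mul_nonneg (pow_nonneg (sub_nonneg.2 hu.2.le) n) hu.1.le
  rw [integral_eq_lintegral_of_nonneg_ae (ae_of_all _ fun ω => sq_nonneg _)
    (hW.pow_const 2).aestronglyMeasurable, hcake]
  refine ENNReal.toReal_le_of_le_ofReal (by positivity) ?_
  calc _ ≤ ENNReal.ofReal 2 * ∫⁻ u in Set.Ioi (0 : ℝ),
          (Set.Ioo 0 1).indicator (fun u => ENNReal.ofReal ((1 - u) ^ n * u)) u :=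
        mul_le_mul_right (setLIntegral_mono' measurableSet_Ioi hbound) _
    _ = ENNReal.ofReal 2 * ENNReal.ofReal (1 / ((n + 1) * (n + 2))) := by
        rw [setLIntegral_indicator measurableSet_Ioo,
          Set.inter_eq_left.2 Set.Ioo_subset_Ioi_self, hbeta]
    _ = ENNReal.ofReal (2 / ((n + 1) * (n + 2))) := by
        rw [← ENNReal.ofReal_mul zero_le_two, mul_one_div]

end SecondMoment

section FoldMin

variable {ι : Type*} {α : ℝ}

lemma measurable_fold_min_rpow (S : Finset ι) :
    Measurable fun x : ι → ℝ => S.fold min 1 fun j => x j ^ (-α) := by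
  classical
  induction S using Finset.induction with
  | empty => simp
  | insert j S hj ih =>
    simp only [Finset.fold_insert hj]
    fun_prop

lemma fold_min_rpow_mem_Icc {x : ι → ℝ} (hx : ∀ k, 1 ≤ x k) (S : Finset ι) :
    (S.fold min 1 fun j => x j ^ (-α)) ∈ Set.Icc 0 1 :=
  ⟨(Finset.le_fold_min 0).2
    ⟨zero_le_one, fun j _ => Real.rpow_nonneg (zero_le_one.trans (hx j)) _⟩,
    (Finset.fold_min_le 1).2 (Or.inl le_rfl)⟩

lemma rpow_le_rpow_neg_mul_one_add_sq {v w N s : ℝ} (hN : 0 < N) (hs0 : 0 ≤ s) (hs2 : s ≤ 2)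
    (hv : 0 ≤ v) (hvw : v ≤ w) : v ^ s ≤ N ^ (-s) * (1 + (N * w) ^ 2) := by
  have hNv : (N * v) ^ s ≤ 1 + (N * w) ^ 2 := by
    rcases le_total (N * v) 1 with h | h
    · linarith [Real.rpow_le_one (by positivity) h hs0, sq_nonneg (N * w)]
    · calc (N * v) ^ s ≤ (N * v) ^ (2 : ℝ) := Real.rpow_le_rpow_of_exponent_le h hs2
        _ = (N * v) ^ 2 := Real.rpow_two _
        _ ≤ (N * w) ^ 2 := by gcongr
        _ ≤ 1 + (N * w) ^ 2 := by simp
  rw [Real.mul_rpow hN.le hv] at hNv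
  rwa [Real.rpow_neg hN.le, inv_mul_eq_div, le_div_iff₀' (by positivity)]

end FoldMin

lemma one_add_sum_mul_prod_one_sub_le {ι : Type*} {s : Finset ι} {a : ι → ℝ}
    (h1 : ∀ i ∈ s, a i ≤ 1) : (1 + ∑ i ∈ s, a i) * ∏ i ∈ s, (1 - a i) ≤ 1 := by
  have hprod : ∏ i ∈ s, (1 - a i) ≤ Real.exp (-∑ i ∈ s, a i) := by
    rw [← Finset.sum_neg_distrib, Real.exp_sum]
    exact Finset.prod_le_prod (fun i hi => sub_nonneg.2 (h1 i hi))
      fun i _ => Real.one_sub_le_exp_neg (a i)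
  calc _ ≤ Real.exp (∑ i ∈ s, a i) * Real.exp (-∑ i ∈ s, a i) := by
        gcongr
        · exact Finset.prod_nonneg fun i hi => sub_nonneg.2 (h1 i hi)
        · linarith [Real.add_one_le_exp (∑ i ∈ s, a i)]
    _ = 1 := by rw [← Real.exp_add, add_neg_cancel, Real.exp_zero]

section ParetoPerturbation

/-- The joint law of independent perturbations of the arms from the Pareto distribution with scale
`1` and shape `α`. -/
abbrev perturbLaw (ι : Type*) [Fintype ι] (α : ℝ) : Measure (ι → ℝ) :=
  Measure.pi fun _ => paretoMeasure 1 α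

variable {ι : Type*} [Fintype ι] {α : ℝ}

lemma isProbabilityMeasure_perturbLaw (ι : Type*) [Fintype ι] (hα : 0 < α) :
    IsProbabilityMeasure (perturbLaw ι α) :=
  have := isProbabilityMeasure_paretoMeasure one_pos hα
  inferInstance

lemma measurePreserving_eval_perturbLaw (hα : 0 < α) (k : ι) :
    MeasurePreserving (Function.eval k) (perturbLaw ι α) (paretoMeasure 1 α) :=
  have := isProbabilityMeasure_paretoMeasure one_pos hα
  measurePreserving_eval (fun _ : ι => paretoMeasure 1 α) k

lemma ae_one_le_perturbLaw (hα : 0 < α) : ∀ᵐ x ∂perturbLaw ι α, ∀ k, 1 ≤ x k :=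
  ae_all_iff.2 fun k => (measurePreserving_eval_perturbLaw hα k).quasiMeasurePreserving.ae
    (ae_le_paretoMeasure 1 α)

lemma integrable_eval_perturbLaw (hα : 1 < α) (k : ι) :
    Integrable (fun x => x k) (perturbLaw ι α) :=
  (measurePreserving_eval_perturbLaw (zero_lt_one.trans hα) k).integrable_comp_of_integrable
    (integrable_id_paretoMeasure one_pos hα)

lemma perturbLaw_real_forall_mem (hα : 0 < α) (S : Finset ι) (s : ι → Set ℝ) :
    (perturbLaw ι α).real {x | ∀ j ∈ S, x j ∈ s j} = ∏ j ∈ S, (paretoMeasure 1 α).real (s j) := by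
  have := isProbabilityMeasure_paretoMeasure one_pos hα
  simp only [measureReal_def, ← ENNReal.toReal_prod]
  exact congrArg ENNReal.toReal (Measure.pi_pi_finset (μ := fun _ => paretoMeasure 1 α) s S)

lemma perturbLaw_real_eval (hα : 0 < α) (k : ι) (s : Set ℝ) :
    (perturbLaw ι α).real {x | x k ∈ s} = (paretoMeasure 1 α).real s := by
  simpa using perturbLaw_real_forall_mem hα {k} fun _ => s

lemma potential_perturbLaw_sub_le (hα : 1 < α) (b : ι) {η β M : ℝ} (hη : 0 < η) (hβ : β ≤ η⁻¹)
    (hM : 1 ≤ M) (L : ι → ℝ) :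
    potential (perturbLaw ι α) b β L - potential (perturbLaw ι α) b η⁻¹ L ≤
      (η⁻¹ - β) * (M * (1 - winProb (perturbLaw ι α) (η • L) b) +
        Fintype.card ι * (α / (α - 1) * M ^ (1 - α))) := by
  have hα0 : 0 < α := zero_lt_one.trans hα
  have := isProbabilityMeasure_perturbLaw ι hα0
  have htail : ∀ k : ι, ∫ x in {x | M < x k}, x k ∂perturbLaw ι α =
      α / (α - 1) * M ^ (1 - α) := fun k => by
    have heval := measurePreserving_eval_perturbLaw (ι := ι) hα0 k
    have hmap := setIntegral_map (μ := perturbLaw ι α) (g := Function.eval k) (f := id)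
      (measurableSet_Ioi (a := M)) (by fun_prop) heval.aemeasurable
    rw [heval.map_eq] at hmap
    exact hmap.symm.trans <| (setIntegral_id_paretoMeasure one_pos hα hM).trans <| by
      rw [Real.one_rpow, mul_one]
  have hnonneg : ∀ᵐ x ∂perturbLaw ι α, ∀ k, 0 ≤ x k := by
    filter_upwards [ae_one_le_perturbLaw hα0] with x hx k using zero_le_one.trans (hx k)
  simpa [htail] using
    potential_sub_le (integrable_eval_perturbLaw hα) hnonneg b hη hβ (zero_le_one.trans hM) L

lemma sq_mul_integral_fold_min_sq_le (hα : 0 < α) (S : Finset ι) :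
    (#S + 1 : ℝ) ^ 2 * ∫ x, (S.fold min 1 fun j => x j ^ (-α)) ^ 2 ∂perturbLaw ι α ≤ 2 := by
  have := isProbabilityMeasure_perturbLaw ι hα
  have := isProbabilityMeasure_paretoMeasure one_pos hα
  have hset : ∀ u < 1, {x : ι → ℝ | u < S.fold min 1 fun j => x j ^ (-α)} =
      {x | ∀ j ∈ S, x j ∈ {y : ℝ | u < y ^ (-α)}} := fun u hu => by
    ext x
    simp [Finset.lt_fold_min, hu]
  have hsq : ∫ x, (S.fold min 1 fun j => x j ^ (-α)) ^ 2 ∂perturbLaw ι α ≤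
      2 / ((#S + 1) * (#S + 2)) := by
    refine integral_sq_le_of_tail_le (measurable_fold_min_rpow S) ?_
      (fun x => (Finset.fold_min_le 1).2 (Or.inl le_rfl)) #S fun u hu => ?_
    · filter_upwards [ae_one_le_perturbLaw hα] with x hx using (fold_min_rpow_mem_Icc hx S).1
    · rw [hset u hu.2, perturbLaw_real_forall_mem hα, ← Finset.prod_const]
      exact Finset.prod_le_prod (fun j _ => measureReal_nonneg) fun j _ =>
        paretoMeasure_real_lt_rpow_neg_le hα hu
  calc _ ≤ (#S + 1 : ℝ) ^ 2 * (2 / ((#S + 1) * (#S + 2))) := by gcongr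
    _ ≤ 2 := by
      rw [mul_div_assoc', div_le_iff₀ (by positivity)]
      nlinarith [(#S).cast_nonneg (α := ℝ)]

lemma perturbLaw_real_half_add_le (hα : 0 < α) (j : ι) {a : ℝ} (ha : 0 ≤ a) :
    (perturbLaw ι α).real {x | x j ∈ Set.Ici (1 / 2 + a)} ≤ 2 ^ α * (1 + a) ^ (-α) := by
  rw [perturbLaw_real_eval hα, paretoMeasure_real_Ici one_pos hα, Real.one_rpow, one_mul]
  calc max 1 (1 / 2 + a) ^ (-α) ≤ ((1 + a) / 2) ^ (-α) :=
        Real.rpow_le_rpow_of_nonpos (by positivity) (le_max_of_le_right (by linarith))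
          (by linarith)
    _ = 2 ^ α * (1 + a) ^ (-α) := by
        rw [Real.div_rpow (by positivity) zero_le_two, Real.rpow_neg zero_le_two, div_inv_eq_mul,
          mul_comm]

section Stability

variable [DecidableEq ι]

lemma winProb_sub_le_gap [Nontrivial ι] (hα : 0 < α) {g : ι → ℝ} (hg : ∀ j, 0 ≤ g j)
    (h0 : ∃ j, g j = 0) (k : ι) {δ : ℝ} (hδ : 0 ≤ δ) :
    winProb (perturbLaw ι α) g k - winProb (perturbLaw ι α) (g + Pi.single k δ) k ≤
      α * (1 + g k) ^ (-(α + 1)) * δ := by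
  have := isProbabilityMeasure_paretoMeasure one_pos hα
  refine (winProb_sub_le_integral _ g k hδ
    (G := fun _ => α * (1 + g k) ^ (-(α + 1)) * δ) (integrable_const _) ?_).trans (by simp)
  filter_upwards [ae_one_le_perturbLaw hα] with x hx z hz
  have hgk := hg k
  have hle : 1 + g k ≤ max 1 z := by
    obtain ⟨j, hj⟩ := h0
    obtain rfl | hjk := eq_or_ne j k
    · simp [hj]
    · have := hz.2 (Set.mem_image_of_mem _ hjk)
      exact le_max_of_le_right (by linarith [hx j])
  calc (paretoMeasure 1 α).real (Set.Ico z (z + δ)) ≤ α * 1 ^ α * max 1 z ^ (-(α + 1)) * δ :=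
        paretoMeasure_real_Ico_le one_pos hα.le z hδ
    _ ≤ α * (1 + g k) ^ (-(α + 1)) * δ := by
        rw [Real.one_rpow, mul_one]
        gcongr α * ?_ * δ
        exact Real.rpow_le_rpow_of_nonpos (by linarith) hle (by linarith)

lemma winProb_sub_le_rank [Nontrivial ι] (hα : 1 ≤ α) {g : ι → ℝ} {k : ι} {S : Finset ι}
    (hS : ∀ j ∈ S, j ≠ k ∧ g j ≤ g k) {δ : ℝ} (hδ : 0 ≤ δ) :
    winProb (perturbLaw ι α) g k - winProb (perturbLaw ι α) (g + Pi.single k δ) k ≤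
      3 * α * (#S + 1 : ℝ) ^ (-((α + 1) / α)) * δ := by
  have hα0 : 0 < α := one_pos.trans_le hα
  have := isProbabilityMeasure_paretoMeasure one_pos hα0
  set N : ℝ := #S + 1
  set s := (α + 1) / α
  let W : (ι → ℝ) → ℝ := fun x => S.fold min 1 fun j => x j ^ (-α)
  have hW : Integrable (fun x => W x ^ 2) (perturbLaw ι α) :=
    Integrable.of_bound ((measurable_fold_min_rpow S).pow_const 2).aestronglyMeasurable 1 <| by
      filter_upwards [ae_one_le_perturbLaw hα0] with x hx
      have := fold_min_rpow_mem_Icc (α := α) hx S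
      rw [Real.norm_of_nonneg (sq_nonneg _)]
      exact pow_le_one₀ this.1 this.2
  have hmean : ∫ x, 1 + N ^ 2 * W x ^ 2 ∂perturbLaw ι α ≤ 3 := by
    have := isProbabilityMeasure_perturbLaw ι hα0
    rw [integral_add (integrable_const 1) (hW.const_mul _), integral_const_mul, integral_const,
      probReal_univ, one_smul]
    linarith [sq_mul_integral_fold_min_sq_le hα0 S]
  refine (winProb_sub_le_integral _ g k hδ
    (G := fun x => α * (N ^ (-s) * (1 + N ^ 2 * W x ^ 2)) * δ) ?_ ?_).trans ?_
  · exact ((((integrable_const 1).add (hW.const_mul _)).const_mul _).const_mul _).mul_const _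
  · filter_upwards [ae_one_le_perturbLaw hα0] with x hx z hz
    have hz1 : (0 : ℝ) < max 1 z := by positivity
    have hvW : max 1 z ^ (-α) ≤ W x := by
      refine (Finset.le_fold_min _).2 ⟨Real.rpow_le_one_of_one_le_of_nonpos
        (le_max_left 1 z) (by linarith), fun j hj => ?_⟩
      have hjz := hz.2 (Set.mem_image_of_mem _ (hS j hj).1)
      exact Real.rpow_le_rpow_of_nonpos (by linarith [hx j])
        (le_max_of_le_right (by linarith [(hS j hj).2])) (by linarith)
    have hv : max 1 z ^ (-(α + 1)) = (max 1 z ^ (-α)) ^ s := by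
      rw [← Real.rpow_mul hz1.le]
      congr 1
      simp only [s]
      field_simp
    calc (paretoMeasure 1 α).real (Set.Ico z (z + δ)) ≤ α * 1 ^ α * max 1 z ^ (-(α + 1)) * δ :=
          paretoMeasure_real_Ico_le one_pos hα0.le z hδ
      _ ≤ α * (N ^ (-s) * (1 + N ^ 2 * W x ^ 2)) * δ := by
          rw [Real.one_rpow, mul_one, hv, ← mul_pow]
          gcongr
          exact rpow_le_rpow_neg_mul_one_add_sq (by positivity) (by positivity)
            ((div_le_iff₀ hα0).2 (by linarith)) (by positivity) hvW
  · rw [integral_mul_const, integral_const_mul, integral_const_mul]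
    calc _ ≤ α * (N ^ (-s) * 3) * δ := by gcongr
      _ = _ := by ring

lemma winProb_sub_le_leader [Nontrivial ι] (hα : 0 < α) {g : ι → ℝ} (hg : ∀ j, 0 ≤ g j) {b : ι}
    (hb : g b = 0) {δ : ℝ} (hδ0 : 0 ≤ δ) (hδ : δ ≤ 1 / 2) :
    winProb (perturbLaw ι α) g b - winProb (perturbLaw ι α) (g + Pi.single b δ) b ≤
      α * 2 ^ α * δ * ∑ j ∈ {b}ᶜ, (1 + g j) ^ (-α) := by
  have := isProbabilityMeasure_perturbLaw ι hα
  have := isProbabilityMeasure_paretoMeasure one_pos hα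
  let E : ι → Set (ι → ℝ) := fun j => {x | x j ∈ Set.Ici (1 / 2 + g j)}
  have hE : ∀ j, MeasurableSet (E j) := fun j => measurable_pi_apply j measurableSet_Ici
  have hint : ∀ j ∈ ({b}ᶜ : Finset ι), Integrable ((E j).indicator 1) (perturbLaw ι α) :=
    fun j _ => (integrable_const (1 : ℝ)).indicator (hE j)
  have hnonneg : ∀ x, ∀ j ∈ ({b}ᶜ : Finset ι), 0 ≤ (E j).indicator (1 : (ι → ℝ) → ℝ) x :=
    fun x j _ => Set.indicator_nonneg (fun _ _ => zero_le_one) x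
  refine (winProb_sub_le_integral _ g b hδ0
    (G := fun x => α * δ * ∑ j ∈ {b}ᶜ, (E j).indicator 1 x)
    ((integrable_finsetSum _ hint).const_mul _) (ae_of_all _ fun x z hz => ?_)).trans ?_
  · obtain ⟨⟨j, hj, rfl⟩, -⟩ := hz
    by_cases hx : x ∈ E j
    · calc _ ≤ α * δ := paretoMeasure_real_Ico_le_mul hα.le _ hδ0
        _ = α * δ * (E j).indicator 1 x := by simp [hx]
        _ ≤ _ := by
            gcongr
            exact Finset.single_le_sum (f := fun j => (E j).indicator 1 x) (hnonneg x)
              (by simpa using hj)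
    · have hx' : x j < 1 / 2 + g j := not_le.1 hx
      rw [paretoMeasure_real_Ico_eq_zero (by linarith)]
      exact mul_nonneg (by positivity) (Finset.sum_nonneg (hnonneg x))
  · rw [integral_const_mul, integral_finsetSum _ hint]
    calc _ ≤ α * δ * ∑ j ∈ {b}ᶜ, 2 ^ α * (1 + g j) ^ (-α) := by
          gcongr with j
          rw [integral_indicator_one (hE j)]
          exact perturbLaw_real_half_add_le hα j (hg j)
      _ = _ := by rw [← Finset.mul_sum]; ring

lemma one_sub_mul_one_sub_prod_le (hα : 0 < α) {g : ι → ℝ} (hg : ∀ j, 0 ≤ g j) (b : ι) :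
    (1 - 2 ^ (-α)) * (1 - ∏ j ∈ {b}ᶜ, (1 - (2 + g j) ^ (-α))) ≤
      1 - winProb (perturbLaw ι α) g b := by
  have := isProbabilityMeasure_perturbLaw ι hα
  let s : ι → Set ℝ := Function.update (fun j => Set.Iio (2 + g j)) b (Set.Iio 2)
  have hlow : (perturbLaw ι α).real {x | x b ∈ Set.Iio 2} = 1 - 2 ^ (-α) := by
    rw [perturbLaw_real_eval hα, paretoMeasure_real_Iio hα one_le_two]
  have hall : (perturbLaw ι α).real {x | ∀ j ∈ Finset.univ, x j ∈ s j} =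
      (1 - 2 ^ (-α)) * ∏ j ∈ {b}ᶜ, (1 - (2 + g j) ^ (-α)) := by
    rw [perturbLaw_real_forall_mem hα, Fintype.prod_eq_mul_prod_compl b]
    congr 1
    · simp [s, paretoMeasure_real_Iio hα]
    · refine Finset.prod_congr rfl fun j hj => ?_
      simp only [s]
      rw [Function.update_of_ne (by simpa using hj),
        paretoMeasure_real_Iio hα (by linarith [hg j])]
  have hsub : {x | ∀ j ∈ Finset.univ, x j ∈ s j} ⊆ {x : ι → ℝ | x b ∈ Set.Iio 2} := fun x hx => by
    simpa [s] using hx b (Finset.mem_univ b)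
  have hwin : {x | x b ∈ Set.Iio 2} \ {x | ∀ j ∈ Finset.univ, x j ∈ s j} ⊆ (winSet g b)ᶜ := by
    rintro x ⟨hxb, hx⟩ hmem
    refine hx fun j _ => ?_
    obtain rfl | hj := eq_or_ne j b
    · simpa [s] using hxb
    · have hxb' : x b < 2 := hxb
      have := hmem j
      simp only [s, Function.update_of_ne hj, Set.mem_Iio]
      linarith [hg b]
  have hmeas : MeasurableSet {x : ι → ℝ | ∀ j ∈ Finset.univ, x j ∈ s j} :=
    MeasurableSet.pi (Finset.countable_toSet _) fun j _ => by
      obtain rfl | hj := eq_or_ne j b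
      · simp [s]
      · simp [s, hj]
  calc _ = (perturbLaw ι α).real ({x | x b ∈ Set.Iio 2} \ {x | ∀ j ∈ Finset.univ, x j ∈ s j}) := by
        rw [measureReal_sdiff hsub hmeas, hlow, hall, mul_one_sub]
    _ ≤ (perturbLaw ι α).real (winSet g b)ᶜ := measureReal_mono hwin
    _ = 1 - winProb (perturbLaw ι α) g b := probReal_compl_eq_one_sub (measurableSet_winSet g b)

lemma one_sub_mul_min_le (hα : 0 < α) {g : ι → ℝ} (hg : ∀ j, 0 ≤ g j) (b : ι) :
    (1 - 2 ^ (-α)) * min 1 (∑ j ∈ {b}ᶜ, (1 + g j) ^ (-α)) ≤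
      (2 ^ α + 1) * (1 - winProb (perturbLaw ι α) g b) := by
  set A := ∑ j ∈ {b}ᶜ, (2 + g j) ^ (-α)
  set m := min 1 (∑ j ∈ {b}ᶜ, (1 + g j) ^ (-α))
  have hA : 0 ≤ A := Finset.sum_nonneg fun j _ => Real.rpow_nonneg (by linarith [hg j]) _
  have htwo : 0 ≤ 1 - (2 : ℝ) ^ (-α) :=
    sub_nonneg.2 (Real.rpow_le_one_of_one_le_of_nonpos one_le_two (by linarith))
  have hmA : m ≤ 2 ^ α * A := by
    refine (min_le_right _ _).trans ?_
    rw [Finset.mul_sum]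
    gcongr with j
    have hj := hg j
    calc (1 + g j) ^ (-α) = 2 ^ α * (2 * (1 + g j)) ^ (-α) := by
          rw [Real.mul_rpow zero_le_two (by positivity), ← mul_assoc, ← Real.rpow_add two_pos,
            add_neg_cancel, Real.rpow_zero, one_mul]
      _ ≤ 2 ^ α * (2 + g j) ^ (-α) := by
          gcongr 2 ^ α * ?_
          exact Real.rpow_le_rpow_of_nonpos (by positivity) (by linarith) (by linarith)
  have hprod : (1 + A) * ∏ j ∈ {b}ᶜ, (1 - (2 + g j) ^ (-α)) ≤ 1 :=
    one_add_sum_mul_prod_one_sub_le fun j _ =>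
      Real.rpow_le_one_of_one_le_of_nonpos (by linarith [hg j]) (by linarith)
  refine le_of_mul_le_mul_right (a := 1 + A) ?_ (by positivity)
  calc (1 - 2 ^ (-α)) * m * (1 + A) = (1 - 2 ^ (-α)) * (m + m * A) := by ring
    _ ≤ (1 - 2 ^ (-α)) * (2 ^ α * A + 1 * A) := by
        gcongr
        exact min_le_left _ _
    _ = (2 ^ α + 1) * ((1 - 2 ^ (-α)) * A) := by ring
    _ ≤ (2 ^ α + 1) *
          ((1 - 2 ^ (-α)) * ((1 - ∏ j ∈ {b}ᶜ, (1 - (2 + g j) ^ (-α))) * (1 + A))) := by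
        gcongr
        linarith
    _ = (2 ^ α + 1) *
          ((1 - 2 ^ (-α)) * (1 - ∏ j ∈ {b}ᶜ, (1 - (2 + g j) ^ (-α)))) * (1 + A) := by ring
    _ ≤ (2 ^ α + 1) * (1 - winProb (perturbLaw ι α) g b) * (1 + A) := by
        gcongr
        exact one_sub_mul_one_sub_prod_le hα hg b

end Stability

end ParetoPerturbation

section RpowSum

lemma sum_range_rpow_neg_le {s : ℝ} (hs0 : 0 ≤ s) (hs1 : s < 1) (n : ℕ) :
    ∑ i ∈ Finset.range n, (i + 1 : ℝ) ^ (-s) ≤ (n : ℝ) ^ (1 - s) / (1 - s) := by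
  have hs : 0 < 1 - s := sub_pos.2 hs1
  induction n with
  | zero => simp [hs.ne']
  | succ n ih =>
    have hn : (0 : ℝ) < n + 1 := by positivity
    have hn1 : 1 / (n + 1 : ℝ) ≤ 1 := by rw [div_le_one hn]; linarith [n.cast_nonneg (α := ℝ)]
    have hsplit : (n : ℝ) ^ (1 - s) = (n + 1) ^ (1 - s) * (1 + -(1 / (n + 1))) ^ (1 - s) := by
      rw [← Real.mul_rpow hn.le (by linarith)]
      congr 1
      field_simp
      ring
    have hbern : (1 + -(1 / (n + 1 : ℝ))) ^ (1 - s) ≤ 1 + (1 - s) * -(1 / (n + 1)) :=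
      rpow_one_add_le_one_add_mul_self (by linarith) hs.le (by linarith)
    have hdiff : (n : ℝ) ^ (1 - s) ≤ (n + 1) ^ (1 - s) - (1 - s) * (n + 1) ^ (-s) := by
      calc _ ≤ (n + 1 : ℝ) ^ (1 - s) * (1 + (1 - s) * -(1 / (n + 1))) := by
            rw [hsplit]
            gcongr
        _ = _ := by
            rw [show -s = 1 - s - 1 by ring, Real.rpow_sub_one hn.ne']
            ring
    rw [Finset.sum_range_succ]
    push_cast
    rw [le_div_iff₀ hs] at ih ⊢
    linarith

end RpowSum

section Exploration

variable {K : ℕ} {α η : ℝ} {L : Fin K → ℝ} {σ : Equiv.Perm (Fin K)}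

lemma lossGap_nonneg (L : Fin K → ℝ) (k : Fin K) : 0 ≤ lossGap L k :=
  sub_nonneg.2 (ciInf_le_of_finite L k)

lemma exists_lossGap_eq_zero [Nonempty (Fin K)] (L : Fin K → ℝ) : ∃ k, lossGap L k = 0 := by
  obtain ⟨k, hk⟩ := exists_eq_ciInf_of_finite (f := L)
  exact ⟨k, sub_eq_zero.2 hk⟩

lemma IsRanking.ne_and_le_of_lt (hσ : IsRanking L σ) {j k : Fin K} (h : σ j < σ k) :
    j ≠ k ∧ L j ≤ L k :=
  ⟨fun hjk => h.ne (congrArg σ hjk), not_lt.1 fun hlt => (hσ k j hlt).not_gt h⟩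

lemma card_filter_rank_lt (σ : Equiv.Perm (Fin K)) (k : Fin K) :
    #{j | σ j < σ k} = (σ k : ℕ) := by
  rw [← Fin.card_Iio (σ k)]
  exact Finset.card_equiv σ (by simp)

lemma exploreWeight_le_gap (hα : -1 ≤ α) (hη : 0 ≤ η) (L : Fin K → ℝ)
    (σ : Equiv.Perm (Fin K)) (k : Fin K) :
    exploreWeight α η L σ k ≤ (1 / (1 + η * lossGap L k)) ^ ((α + 1) / 2) := by
  have := lossGap_nonneg L k
  exact Real.rpow_le_rpow (by positivity) (min_le_left _ _) (by linarith)

lemma exploreWeight_pos (hη : 0 ≤ η) (L : Fin K → ℝ) (σ : Equiv.Perm (Fin K)) (k : Fin K) :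
    0 < exploreWeight α η L σ k := by
  have := lossGap_nonneg L k
  unfold exploreWeight
  positivity

lemma exploreWeight_sq (hη : 0 ≤ η) (L : Fin K → ℝ) (σ : Equiv.Perm (Fin K)) (k : Fin K) :
    exploreWeight α η L σ k ^ 2 =
      min (1 / (1 + η * lossGap L k)) (1 / ((σ k : ℕ) + 1 : ℝ) ^ (1 / α)) ^ (α + 1) := by
  have := lossGap_nonneg L k
  rw [exploreWeight, ← Real.rpow_two, ← Real.rpow_mul (by positivity),
    div_mul_cancel₀ _ two_ne_zero]

lemma sum_exploreWeight_le (hα : 1 < α) (hη : 0 ≤ η) (L : Fin K → ℝ) (σ : Equiv.Perm (Fin K)) :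
    ∑ k, exploreWeight α η L σ k ≤ 2 * α / (α - 1) * (K : ℝ) ^ ((α - 1) / (2 * α)) := by
  have : 0 < α := one_pos.trans hα
  set s := (α + 1) / (2 * α)
  have hs : 1 - s = (α - 1) / (2 * α) := by
    simp only [s]
    field_simp
    ring
  have hterm : ∀ k, exploreWeight α η L σ k ≤ ((σ k : ℕ) + 1 : ℝ) ^ (-s) := fun k => by
    have := lossGap_nonneg L k
    calc exploreWeight α η L σ k ≤ (1 / ((σ k : ℕ) + 1 : ℝ) ^ (1 / α)) ^ ((α + 1) / 2) :=
          Real.rpow_le_rpow (by positivity) (min_le_right _ _) (by positivity)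
      _ = ((σ k : ℕ) + 1 : ℝ) ^ (-s) := by
          rw [one_div, ← Real.rpow_neg (by positivity), ← Real.rpow_mul (by positivity)]
          congr 1
          simp only [s]
          field_simp
  calc ∑ k, exploreWeight α η L σ k ≤ ∑ k, ((σ k : ℕ) + 1 : ℝ) ^ (-s) :=
        Finset.sum_le_sum fun k _ => hterm k
    _ = ∑ k : Fin K, ((k : ℕ) + 1 : ℝ) ^ (-s) :=
        Equiv.sum_comp σ fun k : Fin K => ((k : ℕ) + 1 : ℝ) ^ (-s)
    _ = ∑ i ∈ Finset.range K, (i + 1 : ℝ) ^ (-s) :=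
        Fin.sum_univ_eq_sum_range (fun i : ℕ => (i + 1 : ℝ) ^ (-s)) K
    _ ≤ (K : ℝ) ^ (1 - s) / (1 - s) :=
        sum_range_rpow_neg_le (by positivity) ((div_lt_one (by positivity)).2 (by linarith)) K
    _ = 2 * α / (α - 1) * (K : ℝ) ^ ((α - 1) / (2 * α)) := by
        rw [hs, div_div_eq_mul_div, mul_div_right_comm, mul_comm]
        ring

/-- The decrease of the winning probability of arm `k`, for the learning rate `η`, when its
estimated loss is raised by `v`. -/
def winProbDrop (α η : ℝ) (L : Fin K → ℝ) (k : Fin K) (v : ℝ) : ℝ :=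
  winProb (perturbLaw (Fin K) α) (η • L) k -
    winProb (perturbLaw (Fin K) α) (η • (L + Pi.single k v)) k

lemma winProb_smul_eq (P : Measure (Fin K → ℝ)) (η : ℝ) (L : Fin K → ℝ) :
    winProb P (η • L) = winProb P fun k => η * lossGap L k := by
  ext k
  rw [← winProb_sub_const (η • L) (η * ⨅ j, L j)]
  congr 1
  ext j
  simp only [lossGap, Pi.smul_apply, smul_eq_mul, mul_sub]

lemma winProbDrop_eq (α η : ℝ) (L : Fin K → ℝ) (k : Fin K) (v : ℝ) :
    winProbDrop α η L k v = winProb (perturbLaw (Fin K) α) (fun k => η * lossGap L k) k -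
      winProb (perturbLaw (Fin K) α) ((fun k => η * lossGap L k) + Pi.single k (η * v)) k := by
  have hshift : (fun j => η * (L + Pi.single k v : Fin K → ℝ) j - η * ⨅ i, L i) =
      (fun j => η * lossGap L j) + Pi.single k (η * v) := by
    ext j
    obtain rfl | h := eq_or_ne j k
    · simp [lossGap]
      ring
    · simp [lossGap, h]
      ring
  rw [winProbDrop, winProb_smul_eq, ← hshift, winProb_sub_const]
  rfl

lemma winProbDrop_nonneg (hα : 0 < α) (hη : 0 ≤ η) (L : Fin K → ℝ) (k : Fin K) {v : ℝ}
    (hv : 0 ≤ v) : 0 ≤ winProbDrop α η L k v := by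
  have := isProbabilityMeasure_perturbLaw (Fin K) hα
  rw [winProbDrop_eq, sub_nonneg]
  exact winProb_add_single_le _ _ (by positivity)

lemma winProbDrop_le [Nontrivial (Fin K)] (hα : 1 ≤ α) (hη : 0 ≤ η) (hσ : IsRanking L σ)
    (k : Fin K) {v : ℝ} (hv : 0 ≤ v) :
    winProbDrop α η L k v ≤ 3 * α * η * exploreWeight α η L σ k ^ 2 * v := by
  have hg : ∀ j, 0 ≤ η * lossGap L j := fun j => mul_nonneg hη (lossGap_nonneg L j)
  have hgk := hg k
  rw [winProbDrop_eq, exploreWeight_sq hη]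
  rcases min_choice (1 / (1 + η * lossGap L k)) (1 / ((σ k : ℕ) + 1 : ℝ) ^ (1 / α)) with h | h <;>
    rw [h]
  · obtain ⟨j, hj⟩ := exists_lossGap_eq_zero L
    calc _ ≤ α * (1 + η * lossGap L k) ^ (-(α + 1)) * (η * v) :=
          winProb_sub_le_gap (by linarith) hg ⟨j, by simp [hj]⟩ k (by positivity)
      _ ≤ 3 * α * (1 + η * lossGap L k) ^ (-(α + 1)) * (η * v) := by
          gcongr
          linarith
      _ = _ := by
          rw [one_div, Real.inv_rpow (by positivity), ← Real.rpow_neg (by positivity)]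
          ring
  · have hS : ∀ j ∈ ({j | σ j < σ k} : Finset (Fin K)),
        j ≠ k ∧ η * lossGap L j ≤ η * lossGap L k := fun j hj => by
      have hjk := hσ.ne_and_le_of_lt (Finset.mem_filter.1 hj).2
      exact ⟨hjk.1, mul_le_mul_of_nonneg_left (sub_le_sub_right hjk.2 _) hη⟩
    refine (winProb_sub_le_rank hα hS (by positivity)).trans_eq ?_
    rw [card_filter_rank_lt, one_div, ← Real.rpow_neg (by positivity),
      ← Real.rpow_mul (by positivity), neg_mul, one_div_mul_eq_div]
    ring

lemma winProbDrop_le_leader [Nontrivial (Fin K)] (hα : 0 < α) (hη : 0 ≤ η) {b : Fin K}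
    (hb : lossGap L b = 0) {v : ℝ} (hv : 0 ≤ v) (hηv : η * v ≤ 1 / 2) :
    winProbDrop α η L b v ≤
      α * 2 ^ α * (η * v) * ∑ j ∈ {b}ᶜ, (1 + η * lossGap L j) ^ (-α) := by
  rw [winProbDrop_eq]
  exact winProb_sub_le_leader hα (fun j => mul_nonneg hη (lossGap_nonneg L j)) (by simp [hb])
    (by positivity) hηv

/-- The stability term of a round: the loss incurred through the change of the winning
probabilities caused by the importance-weighted estimate of the losses `ℓ`, averaged over the
explored arm. -/
def stability (α η : ℝ) (L : Fin K → ℝ) (σ : Equiv.Perm (Fin K)) (ℓ : Fin K → ℝ) : ℝ :=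
  ∑ k, ℓ k * winProbDrop α η L k (ℓ k / exploreProb α η L σ k)

lemma mul_winProbDrop_le [Nontrivial (Fin K)] (hα : 1 ≤ α) (hη : 0 ≤ η) (hσ : IsRanking L σ)
    {k : Fin K} {x : ℝ} (hx : x ∈ Set.Icc (0 : ℝ) 1) :
    x * winProbDrop α η L k (x / exploreProb α η L σ k) ≤
      3 * α * η * (∑ j, exploreWeight α η L σ j) * exploreWeight α η L σ k := by
  obtain ⟨hx0, hx1⟩ := hx
  have hq := exploreWeight_pos (α := α) hη L σ
  have hsum : 0 ≤ ∑ j, exploreWeight α η L σ j := Finset.sum_nonneg fun j _ => (hq j).le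
  have hv : 0 ≤ x / exploreProb α η L σ k := div_nonneg hx0 (div_nonneg (hq k).le hsum)
  calc x * winProbDrop α η L k (x / exploreProb α η L σ k)
      ≤ 1 * (3 * α * η * exploreWeight α η L σ k ^ 2 * (x / exploreProb α η L σ k)) :=
        mul_le_mul hx1 (winProbDrop_le hα hη hσ k hv)
          (winProbDrop_nonneg (by linarith) hη L k hv) zero_le_one
    _ = 3 * α * η * (∑ j, exploreWeight α η L σ j) * exploreWeight α η L σ k * x := by
        have := (hq k).ne'
        rw [exploreProb]
        field_simp
    _ ≤ 3 * α * η * (∑ j, exploreWeight α η L σ j) * exploreWeight α η L σ k * 1 := by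
        have := hq k
        gcongr
    _ = _ := mul_one _

lemma stability_le [Nontrivial (Fin K)] (hα : 1 ≤ α) (hη : 0 ≤ η) (hσ : IsRanking L σ)
    {ℓ : Fin K → ℝ} (hℓ : ∀ k, ℓ k ∈ Set.Icc (0 : ℝ) 1) :
    stability α η L σ ℓ ≤ 3 * α * η * (∑ k, exploreWeight α η L σ k) ^ 2 := by
  refine (Finset.sum_le_sum fun k _ => mul_winProbDrop_le hα hη hσ (hℓ k)).trans_eq ?_
  rw [← Finset.mul_sum]
  ring

lemma lossGap_eq_zero_and_rank_eq_zero (hσ : IsRanking L σ) {b : Fin K}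
    (hpos : ∀ j ≠ b, 0 < lossGap L j) : lossGap L b = 0 ∧ (σ b : ℕ) = 0 := by
  have : Nonempty (Fin K) := ⟨b⟩
  have hb : lossGap L b = 0 := by
    obtain ⟨j, hj⟩ := exists_lossGap_eq_zero L
    obtain rfl | hjb := eq_or_ne j b
    · exact hj
    · exact absurd hj (hpos j hjb).ne'
  refine ⟨hb, ?_⟩
  rw [← card_filter_rank_lt, Finset.card_eq_zero, Finset.filter_eq_empty_iff]
  intro j _ hj
  have hjb := hσ.ne_and_le_of_lt hj
  have hgap : lossGap L j ≤ lossGap L b := sub_le_sub_right hjb.2 _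
  exact (hgap.trans_eq hb).not_gt (hpos j hjb.1)

end Exploration

section ShapeThree

variable {K : ℕ} {η κ a : ℝ} {L : Fin K → ℝ} {σ : Equiv.Perm (Fin K)} {ℓ : Fin K → ℝ}

lemma min_one_sum_le_mul_one_sub_winProb {ι : Type*} [Fintype ι] [DecidableEq ι] {g : ι → ℝ}
    (hg : ∀ k, 0 ≤ g k) (b : ι) :
    min 1 (∑ j ∈ {b}ᶜ, (1 + g j) ^ (-3 : ℝ)) ≤ 11 * (1 - winProb (perturbLaw ι 3) g b) := by
  have := isProbabilityMeasure_perturbLaw ι three_pos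
  have h := one_sub_mul_min_le three_pos hg b
  have hx := winProb_le_one (P := perturbLaw ι 3) g b
  rw [show (2 : ℝ) ^ (-3 : ℝ) = 1 / 8 by norm_num, show (2 : ℝ) ^ (3 : ℝ) = 8 by norm_num] at h
  linarith

lemma sum_exploreWeight_three_le (hη : 0 ≤ η) (L : Fin K → ℝ) (σ : Equiv.Perm (Fin K))
    (hκ : 0 ≤ κ) (hκK : κ ^ 3 = K) : ∑ k, exploreWeight 3 η L σ k ≤ 3 * κ := by
  refine (sum_exploreWeight_le (by norm_num) hη L σ).trans_eq ?_
  rw [← hκK, ← Real.rpow_natCast_mul hκ]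
  norm_num

lemma stability_three_le_sq [Nontrivial (Fin K)] (hη : 0 ≤ η) (hσ : IsRanking L σ)
    (hℓ : ∀ k, ℓ k ∈ Set.Icc (0 : ℝ) 1) (hκ : 0 ≤ κ) (hκK : κ ^ 3 = K) :
    stability 3 η L σ ℓ ≤ 81 * η * κ ^ 2 := by
  have hq : ∀ k, 0 ≤ exploreWeight 3 η L σ k := fun k => (exploreWeight_pos hη L σ k).le
  calc stability 3 η L σ ℓ ≤ 3 * 3 * η * (∑ k, exploreWeight 3 η L σ k) ^ 2 :=
        stability_le (by norm_num) hη hσ hℓ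
    _ ≤ 3 * 3 * η * (3 * κ) ^ 2 := by
        gcongr
        · exact Finset.sum_nonneg fun k _ => hq k
        · exact sum_exploreWeight_three_le hη L σ hκ hκK
    _ = 81 * η * κ ^ 2 := by ring

lemma exploreWeight_three_le (hη : 0 ≤ η) (ha : 0 < a) (L : Fin K → ℝ)
    (σ : Equiv.Perm (Fin K)) (k : Fin K) :
    exploreWeight 3 η L σ k ≤ a * (1 + η * lossGap L k) ^ (-3 : ℝ) + 1 / a ^ 2 := by
  have := lossGap_nonneg L k
  set s := 1 / (1 + η * lossGap L k) with hs
  have : 0 ≤ s := by positivity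
  have hcube : (1 + η * lossGap L k) ^ (-3 : ℝ) = s ^ 3 := by
    rw [hs, one_div, inv_pow, Real.rpow_neg (by positivity)]
    norm_cast
  rw [hcube]
  refine (exploreWeight_le_gap (by norm_num) hη L σ k).trans ?_
  norm_num only
  rw [Real.rpow_ofNat]
  rcases le_total 1 (a * s) with has | has
  · have h : 1 * s ^ 2 ≤ a * s * s ^ 2 := by gcongr
    have : 0 ≤ 1 / a ^ 2 := by positivity
    linarith [h.trans_eq (by ring : a * s * s ^ 2 = a * s ^ 3)]
  · have h : s ^ 2 ≤ 1 / a ^ 2 := by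
      rw [le_div_iff₀ (by positivity), ← mul_pow, mul_comm]
      exact pow_le_one₀ (by positivity) has
    exact h.trans (le_add_of_nonneg_left (by positivity))

lemma sum_compl_exploreWeight_three_le (hη : 0 ≤ η) (ha : 0 < a) (L : Fin K → ℝ)
    (σ : Equiv.Perm (Fin K)) (b : Fin K) :
    ∑ k ∈ {b}ᶜ, exploreWeight 3 η L σ k ≤
      a * ∑ k ∈ {b}ᶜ, (1 + η * lossGap L k) ^ (-3 : ℝ) + K / a ^ 2 := by
  have hcard : (#({b}ᶜ : Finset (Fin K)) : ℝ) ≤ K := by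
    exact_mod_cast (Finset.card_le_univ _).trans_eq (Fintype.card_fin K)
  calc _ ≤ ∑ k ∈ {b}ᶜ, (a * (1 + η * lossGap L k) ^ (-3 : ℝ) + 1 / a ^ 2) :=
        Finset.sum_le_sum fun k _ => exploreWeight_three_le hη ha L σ k
    _ = a * ∑ k ∈ {b}ᶜ, (1 + η * lossGap L k) ^ (-3 : ℝ) +
          #({b}ᶜ : Finset (Fin K)) / a ^ 2 := by
        rw [Finset.sum_add_distrib, Finset.mul_sum, Finset.sum_const, nsmul_eq_mul, mul_one_div]
    _ ≤ _ := by gcongr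

lemma exploreWeight_eq_one {α : ℝ} {b : Fin K} (hb : lossGap L b = 0) (hσb : (σ b : ℕ) = 0) :
    exploreWeight α η L σ b = 1 := by
  simp [exploreWeight, hb, hσb]

lemma sum_one_add_lossGap_rpow_nonneg (hη : 0 ≤ η) (L : Fin K → ℝ) (s : Finset (Fin K)) (x : ℝ) :
    0 ≤ ∑ k ∈ s, (1 + η * lossGap L k) ^ x :=
  Finset.sum_nonneg fun k _ => by have := lossGap_nonneg L k; positivity

lemma leader_term_le [Nontrivial (Fin K)] (hη : 0 ≤ η) {b : Fin K} (hb : lossGap L b = 0)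
    (hσb : (σ b : ℕ) = 0) {x : ℝ} (hx : x ∈ Set.Icc (0 : ℝ) 1) (hκ : 0 ≤ κ) (hκK : κ ^ 3 = K)
    (hηκ : 6 * η * κ ≤ 1) :
    x * winProbDrop 3 η L b (x / exploreProb 3 η L σ b) ≤
      72 * η * κ * ∑ k ∈ {b}ᶜ, (1 + η * lossGap L k) ^ (-3 : ℝ) := by
  obtain ⟨hx0, hx1⟩ := hx
  have hsum := sum_exploreWeight_three_le hη L σ hκ hκK
  have hsum0 : 0 ≤ ∑ k, exploreWeight 3 η L σ k :=
    Finset.sum_nonneg fun k _ => (exploreWeight_pos hη L σ k).le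
  have hv : x / exploreProb 3 η L σ b = x * ∑ k, exploreWeight 3 η L σ k := by
    rw [exploreProb, exploreWeight_eq_one hb hσb, div_div_eq_mul_div, div_one]
  have hv1 : x * ∑ k, exploreWeight 3 η L σ k ≤ 3 * κ := by nlinarith
  have := sum_one_add_lossGap_rpow_nonneg hη L {b}ᶜ (-3)
  have hηv : η * (x * ∑ k, exploreWeight 3 η L σ k) ≤ η * (3 * κ) := by gcongr
  rw [hv]
  calc _ ≤ 1 * (3 * 2 ^ (3 : ℝ) * (η * (x * ∑ k, exploreWeight 3 η L σ k)) *
          ∑ k ∈ {b}ᶜ, (1 + η * lossGap L k) ^ (-3 : ℝ)) :=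
        mul_le_mul hx1 (winProbDrop_le_leader three_pos hη hb (by positivity) (by linarith))
          (winProbDrop_nonneg three_pos hη L b (by positivity)) zero_le_one
    _ ≤ 1 * (3 * 2 ^ (3 : ℝ) * (η * (3 * κ)) *
          ∑ k ∈ {b}ᶜ, (1 + η * lossGap L k) ^ (-3 : ℝ)) := by gcongr
    _ = _ := by
        rw [show (2 : ℝ) ^ (3 : ℝ) = 8 by norm_num]
        ring

lemma stability_three_le_of_leader [Nontrivial (Fin K)] (hη : 0 ≤ η) (hσ : IsRanking L σ)
    (hℓ : ∀ k, ℓ k ∈ Set.Icc (0 : ℝ) 1) (hκ : 0 ≤ κ) (hκK : κ ^ 3 = K) (hηκ : 6 * η * κ ≤ 1)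
    (ha : 1 ≤ a) {b : Fin K} (hpos : ∀ j ≠ b, 0 < lossGap L j) :
    stability 3 η L σ ℓ ≤
      99 * η * κ * (a * ∑ k ∈ {b}ᶜ, (1 + η * lossGap L k) ^ (-3 : ℝ) + K / a ^ 2) := by
  obtain ⟨hb, hσb⟩ := lossGap_eq_zero_and_rank_eq_zero hσ hpos
  have hy := sum_one_add_lossGap_rpow_nonneg hη L {b}ᶜ (-3)
  set y := ∑ k ∈ {b}ᶜ, (1 + η * lossGap L k) ^ (-3 : ℝ)
  have hothers : ∑ k ∈ {b}ᶜ, ℓ k * winProbDrop 3 η L k (ℓ k / exploreProb 3 η L σ k) ≤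
      27 * η * κ * (a * y + K / a ^ 2) := by
    calc _ ≤ ∑ k ∈ {b}ᶜ, 3 * 3 * η * (∑ j, exploreWeight 3 η L σ j) * exploreWeight 3 η L σ k :=
          Finset.sum_le_sum fun k _ => mul_winProbDrop_le (by norm_num) hη hσ (hℓ k)
      _ = 3 * 3 * η * (∑ j, exploreWeight 3 η L σ j) * ∑ k ∈ {b}ᶜ, exploreWeight 3 η L σ k :=
          (Finset.mul_sum _ _ _).symm
      _ ≤ 3 * 3 * η * (3 * κ) * (a * y + K / a ^ 2) := by
          gcongr
          · exact Finset.sum_nonneg fun k _ => (exploreWeight_pos hη L σ k).le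
          · exact sum_exploreWeight_three_le hη L σ hκ hκK
          · exact sum_compl_exploreWeight_three_le hη (by linarith) L σ b
      _ = _ := by ring
  have hleader := leader_term_le hη hb hσb (hℓ b) hκ hκK hηκ
  have hya : 72 * η * κ * y ≤ 72 * η * κ * (a * y + K / a ^ 2) := by
    gcongr
    exact (le_mul_of_one_le_left hy ha).trans (le_add_of_nonneg_right (by positivity))
  rw [stability, Fintype.sum_eq_add_sum_compl b]
  linarith

lemma le_add_pow_three_div_sq (hκ : 0 ≤ κ) (ha : 0 < a) : κ ≤ a + κ ^ 3 / a ^ 2 := by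
  rcases le_total κ a with h | h
  · exact h.trans (le_add_of_nonneg_right (by positivity))
  · have : κ ≤ κ ^ 3 / a ^ 2 := by
      rw [le_div_iff₀ (by positivity)]
      calc κ * a ^ 2 ≤ κ * κ ^ 2 := by gcongr
        _ = κ ^ 3 := by ring
    linarith

lemma one_le_sum_or_lossGap_pos (hη : 0 ≤ η) (L : Fin K → ℝ) (b : Fin K) (x : ℝ) :
    1 ≤ ∑ k ∈ {b}ᶜ, (1 + η * lossGap L k) ^ x ∨ ∀ j ≠ b, 0 < lossGap L j := by
  by_contra! h
  obtain ⟨hlt, j, hj, hgap⟩ := h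
  have hterm : (1 + η * lossGap L j) ^ x ≤ ∑ k ∈ {b}ᶜ, (1 + η * lossGap L k) ^ x :=
    Finset.single_le_sum (f := fun k => (1 + η * lossGap L k) ^ x)
      (fun k _ => by have := lossGap_nonneg L k; positivity) (by simpa using hj)
  rw [hgap.antisymm (lossGap_nonneg L j), mul_zero, add_zero, Real.one_rpow] at hterm
  exact hlt.not_ge hterm

lemma stability_three_le [Nontrivial (Fin K)] (hη : 0 ≤ η) (hσ : IsRanking L σ)
    (hℓ : ∀ k, ℓ k ∈ Set.Icc (0 : ℝ) 1) (hκ : 0 ≤ κ) (hκK : κ ^ 3 = K) (hηκ : 6 * η * κ ≤ 1)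
    (ha : 1 ≤ a) (b : Fin K) :
    stability 3 η L σ ℓ ≤
      1089 * η * κ * (a * (1 - winProb (perturbLaw (Fin K) 3) (η • L) b) + K / a ^ 2) := by
  have hgap : ∀ k, 0 ≤ η * lossGap L k := fun k => mul_nonneg hη (lossGap_nonneg L k)
  have hmass := min_one_sum_le_mul_one_sub_winProb hgap b
  rw [← winProb_smul_eq] at hmass
  set x := 1 - winProb (perturbLaw (Fin K) 3) (η • L) b
  set y := ∑ k ∈ {b}ᶜ, (1 + η * lossGap L k) ^ (-3 : ℝ)
  have hcases : 1 ≤ 11 * x ∨ (y ≤ 11 * x ∧ ∀ j ≠ b, 0 < lossGap L j) := by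
    rcases min_le_iff.1 hmass with hx | hy
    · exact Or.inl hx
    · exact (one_le_sum_or_lossGap_pos hη L b (-3)).imp (fun h => h.trans hy) (fun h => ⟨hy, h⟩)
  have hKa : 0 ≤ K / a ^ 2 := by positivity
  rcases hcases with hx | ⟨hy, hpos⟩
  · have hκa : κ ≤ 11 * (a * x + K / a ^ 2) := by
      have := le_add_pow_three_div_sq hκ (one_pos.trans_le ha)
      rw [hκK] at this
      nlinarith
    calc stability 3 η L σ ℓ ≤ 81 * η * κ ^ 2 := stability_three_le_sq hη hσ hℓ hκ hκK
      _ = 81 * η * κ * κ := by ring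
      _ ≤ 99 * η * κ * (11 * (a * x + K / a ^ 2)) := by
          gcongr
          norm_num
      _ = _ := by ring
  · calc stability 3 η L σ ℓ ≤ 99 * η * κ * (a * y + K / a ^ 2) :=
          stability_three_le_of_leader hη hσ hℓ hκ hκK hηκ ha hpos
      _ ≤ 99 * η * κ * (a * (11 * x) + 11 * (K / a ^ 2)) := by
          gcongr
          linarith
      _ = _ := by ring

end ShapeThree

section Freezing

variable {Ω E F : Type*} {G m : MeasurableSpace Ω} [MeasurableSpace E] [MeasurableSpace F]
  {μ : Measure Ω} [IsProbabilityMeasure μ] {X : Ω → E} {r : Ω → F}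

lemma map_prodMk_restrict_of_indep (hG : G ≤ m) (hX : Measurable[G] X) (hr : Measurable r)
    (hind : Indep (MeasurableSpace.comap r inferInstance) G μ) {s : Set Ω}
    (hs : MeasurableSet[G] s) :
    (μ.restrict s).map (fun ω => (X ω, r ω)) = ((μ.restrict s).map X).prod (μ.map r) := by
  have hX' : Measurable X := hX.mono hG le_rfl
  refine (Measure.prod_eq fun A B hA hB => ?_).symm
  rw [Measure.map_apply (hX'.prodMk hr) (hA.prod hB), Measure.map_apply hX' hA,
    Measure.map_apply hr hB, Measure.restrict_apply (hX'.prodMk hr (hA.prod hB)),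
    Measure.restrict_apply (hX' hA), Set.mk_preimage_prod, mul_comm,
    ← (Indep_iff _ _ μ).1 hind _ _ ⟨B, hB, rfl⟩ ((hX hA).inter hs),
    Set.inter_right_comm, Set.inter_comm]

lemma condExp_indicator_mem_of_indep (hG : G ≤ m) (hX : Measurable[G] X) (hr : Measurable r)
    (hind : Indep (MeasurableSpace.comap r inferInstance) G μ) {P : Set (E × F)}
    (hP : MeasurableSet P) :
    μ[{ω | (X ω, r ω) ∈ P}.indicator (fun _ => (1 : ℝ)) | G] =ᵐ[μ]
      fun ω => (μ.map r).real {ρ | (X ω, ρ) ∈ P} := by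
  have : IsProbabilityMeasure (μ.map r) := Measure.isProbabilityMeasure_map hr.aemeasurable
  have hX' : Measurable X := hX.mono hG le_rfl
  have hXr : Measurable fun ω => (X ω, r ω) := hX'.prodMk hr
  have hf : Measurable fun x => (μ.map r).real {ρ | (x, ρ) ∈ P} :=
    (measurable_measure_prodMk_left hP).ennreal_toReal
  have hp : Integrable (fun ω => (μ.map r).real {ρ | (X ω, ρ) ∈ P}) μ :=
    .of_mem_Icc 0 1 (hf.comp hX').aemeasurable
      (ae_of_all _ fun ω => ⟨measureReal_nonneg, measureReal_le_one⟩)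
  refine (ae_eq_condExp_of_forall_setIntegral_eq hG
    ((integrable_const _).indicator (hXr hP)) (fun s _ _ => hp.integrableOn) (fun s hs _ => ?_)
    (hf.comp hX).stronglyMeasurable.aestronglyMeasurable).symm
  have hPx := measurable_measure_prodMk_left (ν := μ.map r) hP
  calc ∫ ω in s, (μ.map r).real {ρ | (X ω, ρ) ∈ P} ∂μ
      = ∫ x, (μ.map r).real {ρ | (x, ρ) ∈ P} ∂(μ.restrict s).map X :=
        (integral_map hX'.aemeasurable hf.aestronglyMeasurable).symm
    _ = (((μ.restrict s).map X).prod (μ.map r)).real P := by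
        rw [measureReal_def, Measure.prod_apply hP]
        exact integral_toReal hPx.aemeasurable (ae_of_all _ fun x => measure_lt_top _ _)
    _ = (μ.restrict s).real {ω | (X ω, r ω) ∈ P} := by
        rw [← map_prodMk_restrict_of_indep hG hX hr hind hs, map_measureReal_apply hXr hP]
        rfl
    _ = ∫ ω in s, {ω | (X ω, r ω) ∈ P}.indicator (fun _ => (1 : ℝ)) ω ∂μ :=
        (integral_indicator_one (hXr hP)).symm

lemma ae_notMem_of_indep (hG : G ≤ m) (hX : Measurable[G] X) (hr : Measurable r)
    (hind : Indep (MeasurableSpace.comap r inferInstance) G μ) {P : Set (E × F)}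
    (hP : MeasurableSet P) (hnull : ∀ x, μ.map r {ρ | (x, ρ) ∈ P} = 0) :
    ∀ᵐ ω ∂μ, (X ω, r ω) ∉ P := by
  have hXr : Measurable fun ω => (X ω, r ω) := (hX.mono hG le_rfl).prodMk hr
  have : IsProbabilityMeasure (μ.map r) := Measure.isProbabilityMeasure_map hr.aemeasurable
  have hmap := map_prodMk_restrict_of_indep hG hX hr hind .univ
  rw [Measure.restrict_univ] at hmap
  refine measure_eq_zero_iff_ae_notMem.1 ((Measure.map_apply hXr hP).symm.trans ?_)
  rw [hmap, Measure.measure_prod_null hP]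
  exact ae_of_all _ hnull

lemma integral_mul_eq_of_condExp_ae_eq (hG : G ≤ m) {Y p f : Ω → ℝ} {A B : ℝ} (hY : Integrable Y μ)
    (hp : μ[Y | G] =ᵐ[μ] p) (hf : Measurable[G] f) (hfB : ∀ ω, f ω ∈ Set.Icc A B) :
    ∫ ω, Y ω * f ω ∂μ = ∫ ω, p ω * f ω ∂μ := by
  have hYf : Integrable (Y * f) μ := hY.mul_bdd (c := max |A| |B|)
    (hf.mono hG le_rfl).aestronglyMeasurable
    (ae_of_all _ fun ω => abs_le_max_abs_abs (hfB ω).1 (hfB ω).2)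
  calc ∫ ω, Y ω * f ω ∂μ = ∫ ω, (μ[Y * f | G]) ω ∂μ := (integral_condExp hG).symm
    _ = ∫ ω, p ω * f ω ∂μ := integral_congr_ae <|
        (condExp_mul_of_stronglyMeasurable_right hf.stronglyMeasurable hYf hY).trans
          (hp.mul .rfl)

lemma integral_apply_eq_sum_of_condExp {κ : Type*} [Fintype κ] [MeasurableSpace κ]
    [MeasurableSingletonClass κ] (hG : G ≤ m) {a : Ω → κ} (ha : Measurable a) {p f : κ → Ω → ℝ}
    {A B : ℝ} (hp : ∀ k, μ[{ω | a ω = k}.indicator (fun _ => (1 : ℝ)) | G] =ᵐ[μ] p k)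
    (hf : ∀ k, Measurable[G] (f k)) (hfB : ∀ k ω, f k ω ∈ Set.Icc A B) :
    ∫ ω, f (a ω) ω ∂μ = ∑ k, ∫ ω, p k ω * f k ω ∂μ := by
  have hY : ∀ k, Integrable ({ω | a ω = k}.indicator fun _ => (1 : ℝ)) μ := fun k =>
    (integrable_const _).indicator (ha (measurableSet_singleton k))
  have hYf : ∀ k, Integrable
      (fun ω => {ω | a ω = k}.indicator (fun _ => (1 : ℝ)) ω * f k ω) μ := fun k =>
    (hY k).mul_bdd (c := max |A| |B|) ((hf k).mono hG le_rfl).aestronglyMeasurable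
      (ae_of_all _ fun ω => abs_le_max_abs_abs (hfB k ω).1 (hfB k ω).2)
  have hsum : ∀ ω, f (a ω) ω =
      ∑ k, {ω | a ω = k}.indicator (fun _ => (1 : ℝ)) ω * f k ω := by
    classical
    simp [Set.indicator_apply]
  simp_rw [hsum, integral_finsetSum _ fun k _ => hYf k,
    integral_mul_eq_of_condExp_ae_eq hG (hY _) (hp _) (hf _) (hfB _)]

lemma integrable_apply_of_mem_Icc {κ : Type*} [Countable κ] [MeasurableSpace κ]
    [MeasurableSingletonClass κ] {a : Ω → κ} (ha : Measurable a) {f : κ → Ω → ℝ} {A B : ℝ}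
    (hf : ∀ k, Measurable (f k)) (hfB : ∀ k ω, f k ω ∈ Set.Icc A B) :
    Integrable (fun ω => f (a ω) ω) μ :=
  .of_mem_Icc A B ((measurable_from_prod_countable_right (f := fun p : κ × Ω => f p.1 p.2)
    hf).comp (ha.prodMk measurable_id)).aemeasurable (ae_of_all _ fun ω => hfB (a ω) ω)

end Freezing

section EstimateBounds

variable {K : ℕ} {α η B : ℝ} {L : Fin K → ℝ}

lemma exploreProb_pos (hη : 0 ≤ η) (L : Fin K → ℝ) (σ : Equiv.Perm (Fin K)) (k : Fin K) :
    0 < exploreProb α η L σ k :=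
  div_pos (exploreWeight_pos hη L σ k)
    (Finset.sum_pos (fun j _ => exploreWeight_pos hη L σ j) ⟨k, Finset.mem_univ k⟩)

lemma lossGap_le (hL : ∀ k, L k ∈ Set.Icc 0 B) (k : Fin K) : lossGap L k ≤ B := by
  have : Nonempty (Fin K) := ⟨k⟩
  have : 0 ≤ ⨅ j, L j := le_ciInf fun j => (hL j).1
  have := (hL k).2
  unfold lossGap
  linarith

lemma exploreWeight_le_one (hα : 0 ≤ α) (hη : 0 ≤ η) (L : Fin K → ℝ) (σ : Equiv.Perm (Fin K))
    (k : Fin K) : exploreWeight α η L σ k ≤ 1 := by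
  have := mul_nonneg hη (lossGap_nonneg L k)
  refine (exploreWeight_le_gap (by linarith) hη L σ k).trans
    (Real.rpow_le_one (by positivity) ?_ (by positivity))
  rw [div_le_one (by positivity)]
  linarith

lemma one_div_exploreWeight_le (hα : 0 ≤ α) (hη : 0 ≤ η) (hL : ∀ k, L k ∈ Set.Icc 0 B)
    (σ : Equiv.Perm (Fin K)) (k : Fin K) :
    1 / exploreWeight α η L σ k ≤ max (1 + η * B) ((K : ℝ) ^ (1 / α)) ^ ((α + 1) / 2) := by
  have hgap := lossGap_nonneg L k
  have hB : 0 ≤ B := hgap.trans (lossGap_le hL k)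
  have hrank : ((σ k : ℕ) + 1 : ℝ) ≤ K := by exact_mod_cast (σ k).isLt
  set X := max (1 + η * B) ((K : ℝ) ^ (1 / α))
  have hX : 0 < X := lt_max_of_lt_left (by positivity)
  rw [one_div_le (exploreWeight_pos hη L σ k) (by positivity), one_div,
    ← Real.inv_rpow hX.le, ← one_div]
  refine Real.rpow_le_rpow (by positivity) (le_min ?_ ?_) (by positivity)
  · exact one_div_le_one_div_of_le (by positivity) (le_max_of_le_left (by
      gcongr; exact lossGap_le hL k))
  · exact one_div_le_one_div_of_le (by positivity) (le_max_of_le_right (by gcongr))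

lemma one_div_exploreProb_le (hα : 0 ≤ α) (hη : 0 ≤ η) (hL : ∀ k, L k ∈ Set.Icc 0 B)
    (σ : Equiv.Perm (Fin K)) (k : Fin K) :
    1 / exploreProb α η L σ k ≤
      K * max (1 + η * B) ((K : ℝ) ^ (1 / α)) ^ ((α + 1) / 2) := by
  have hsum : ∑ j, exploreWeight α η L σ j ≤ K :=
    (Finset.sum_le_sum fun j _ => exploreWeight_le_one hα hη L σ j).trans_eq (by simp)
  have hq := exploreWeight_pos (α := α) hη L σ k
  calc 1 / exploreProb α η L σ k
      = (∑ j, exploreWeight α η L σ j) * (1 / exploreWeight α η L σ k) := by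
        rw [exploreProb, one_div_div, div_eq_mul_one_div]
    _ ≤ _ := by gcongr; exact one_div_exploreWeight_le hα hη hL σ k

lemma exists_estLoss_mem_Icc (hα : 0 ≤ α) {η : ℕ → ℝ} (hη : ∀ t, 0 ≤ η t) (K t : ℕ) :
    ∃ B, ∀ (ℓ : ℕ → Fin K → ℝ) (σ : ℕ → Equiv.Perm (Fin K)) (j : ℕ → Fin K),
      (∀ s < t, ∀ k, ℓ s k ∈ Set.Icc (0 : ℝ) 1) →
        ∀ k, estLoss α η ℓ σ j t k ∈ Set.Icc (0 : ℝ) B := by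
  induction t with
  | zero => exact ⟨0, fun _ _ _ _ _ => by simp [estLoss]⟩
  | succ t ih =>
    obtain ⟨B, hB⟩ := ih
    refine ⟨B + K * max (1 + η t * B) ((K : ℝ) ^ (1 / α)) ^ ((α + 1) / 2),
      fun ℓ σ j hℓ k => ?_⟩
    have hL := hB ℓ σ j fun s hs => hℓ s (hs.trans t.lt_succ_self)
    have hp := exploreProb_pos (α := α) (hη t) (estLoss α η ℓ σ j t) (σ t) k
    obtain ⟨h0, h1⟩ := hℓ t t.lt_succ_self k
    have hv : ℓ t k / exploreProb α (η t) (estLoss α η ℓ σ j t) (σ t) k ≤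
        K * max (1 + η t * B) ((K : ℝ) ^ (1 / α)) ^ ((α + 1) / 2) :=
      (div_le_div_of_nonneg_right h1 hp.le).trans (one_div_exploreProb_le hα (hη t) hL (σ t) k)
    have hv0 := div_nonneg h0 hp.le
    rw [estLoss, Pi.add_apply]
    obtain rfl | hk := eq_or_ne k (j t)
    · rw [Pi.single_eq_same]
      exact ⟨add_nonneg (hL _).1 hv0, add_le_add (hL _).2 hv⟩
    · rw [Pi.single_eq_of_ne hk, add_zero]
      exact ⟨(hL k).1, by linarith [(hL k).2]⟩

end EstimateBounds

section Measurability

variable {K : ℕ} {Ω : Type*} {_ : MeasurableSpace Ω} {L : Ω → Fin K → ℝ}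
  {σ : Ω → Equiv.Perm (Fin K)}

lemma measurable_lossGap (hL : Measurable L) (k : Fin K) : Measurable fun ω => lossGap (L ω) k :=
  hL.eval.sub (.iInf fun _ => hL.eval)

lemma measurable_exploreWeight (α η : ℝ) (hL : Measurable L) (hσ : ∀ k, Measurable fun ω => σ ω k)
    (k : Fin K) : Measurable fun ω => exploreWeight α η (L ω) (σ ω) k := by
  have hrank : Measurable fun ω => 1 / (((σ ω k : ℕ) + 1 : ℝ) ^ (1 / α)) :=
    (measurable_of_finite fun n : Fin K => 1 / (((n : ℕ) + 1 : ℝ) ^ (1 / α))).comp (hσ k)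
  exact ((((measurable_lossGap hL k).const_mul η).const_add 1).const_div 1 |>.min hrank).pow_const _

lemma measurable_exploreProb (α η : ℝ) (hL : Measurable L) (hσ : ∀ k, Measurable fun ω => σ ω k)
    (k : Fin K) : Measurable fun ω => exploreProb α η (L ω) (σ ω) k :=
  (measurable_exploreWeight α η hL hσ k).div
    (Finset.measurable_fun_sum _ fun j _ => measurable_exploreWeight α η hL hσ j)

lemma measurable_add_single (hL : Measurable L) {a : Ω → Fin K} (ha : Measurable a)
    {v : Fin K → Ω → ℝ} (hv : ∀ k, Measurable (v k)) :
    Measurable fun ω => L ω + Pi.single (a ω) (v (a ω) ω) := by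
  have hsingle : (fun ω => (Pi.single (a ω) (v (a ω) ω) : Fin K → ℝ)) =
      fun ω k => {ω | a ω = k}.indicator (v k) ω := by
    ext ω k
    obtain rfl | hk := eq_or_ne k (a ω)
    · simp
    · simp [hk, hk.symm]
  refine hL.add (hsingle ▸ measurable_pi_lambda _ fun k => ?_)
  exact (hv k).indicator (ha (measurableSet_singleton k))

end Measurability

section Run

variable {K : ℕ} {Ω : Type*} {α : ℝ} {η : ℕ → ℝ} {T t : ℕ} {ℓ r : ℕ → Ω → Fin K → ℝ}
  {σ : ℕ → Ω → Equiv.Perm (Fin K)} {i j : ℕ → Ω → Fin K}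

/-- The estimated cumulative losses at the beginning of round `t` of a run, as a random vector. -/
def runLoss (α : ℝ) (η : ℕ → ℝ) (ℓ : ℕ → Ω → Fin K → ℝ) (σ : ℕ → Ω → Equiv.Perm (Fin K))
    (j : ℕ → Ω → Fin K) (t : ℕ) (ω : Ω) : Fin K → ℝ :=
  estLoss α η (fun s => ℓ s ω) (fun s => σ s ω) (fun s => j s ω) t

/-- The importance-weighted loss of arm `k` in round `t`, by which its estimated cumulative loss
grows in case arm `k` is the explored one. -/
def weightedLoss (α : ℝ) (η : ℕ → ℝ) (ℓ : ℕ → Ω → Fin K → ℝ) (σ : ℕ → Ω → Equiv.Perm (Fin K))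
    (j : ℕ → Ω → Fin K) (t : ℕ) (k : Fin K) (ω : Ω) : ℝ :=
  ℓ t ω k / exploreProb α (η t) (runLoss α η ℓ σ j t ω) (σ t ω) k

/-- The probability, given the history, that arm `k` is exploited in round `t`. -/
def exploitProb (α : ℝ) (η : ℕ → ℝ) (ℓ : ℕ → Ω → Fin K → ℝ) (σ : ℕ → Ω → Equiv.Perm (Fin K))
    (j : ℕ → Ω → Fin K) (t : ℕ) (k : Fin K) (ω : Ω) : ℝ :=
  winProb (perturbLaw (Fin K) α) (η t • runLoss α η ℓ σ j t ω) k

/-- The probability that arm `k` would be exploited, still at the learning rate of round `t`, after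
an exploration of `k` in that round. -/
def lookaheadProb (α : ℝ) (η : ℕ → ℝ) (ℓ : ℕ → Ω → Fin K → ℝ) (σ : ℕ → Ω → Equiv.Perm (Fin K))
    (j : ℕ → Ω → Fin K) (t : ℕ) (k : Fin K) (ω : Ω) : ℝ :=
  winProb (perturbLaw (Fin K) α)
    (η t • (runLoss α η ℓ σ j t ω + Pi.single k (weightedLoss α η ℓ σ j t k ω))) k

lemma runLoss_succ (α : ℝ) (η : ℕ → ℝ) (ℓ : ℕ → Ω → Fin K → ℝ)
    (σ : ℕ → Ω → Equiv.Perm (Fin K)) (j : ℕ → Ω → Fin K) (t : ℕ) (ω : Ω) :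
    runLoss α η ℓ σ j (t + 1) ω = runLoss α η ℓ σ j t ω +
      Pi.single (j t ω) (weightedLoss α η ℓ σ j t (j t ω) ω) :=
  rfl

lemma exploreProb_mul_weightedLoss (hη : ∀ t, 0 ≤ η t) (ℓ : ℕ → Ω → Fin K → ℝ)
    (σ : ℕ → Ω → Equiv.Perm (Fin K)) (j : ℕ → Ω → Fin K) (t : ℕ) (k : Fin K) (ω : Ω) :
    exploreProb α (η t) (runLoss α η ℓ σ j t ω) (σ t ω) k * weightedLoss α η ℓ σ j t k ω =
      ℓ t ω k :=
  mul_div_cancel₀ _ (exploreProb_pos (hη t) _ _ k).ne'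

lemma exists_runLoss_mem_Icc (hα : 0 ≤ α) (hη : ∀ t, 0 ≤ η t)
    (hℓ : ∀ t < T, ∀ ω k, ℓ t ω k ∈ Set.Icc (0 : ℝ) 1) (σ : ℕ → Ω → Equiv.Perm (Fin K))
    (j : ℕ → Ω → Fin K) (ht : t ≤ T) :
    ∃ B, ∀ ω k, runLoss α η ℓ σ j t ω k ∈ Set.Icc 0 B := by
  obtain ⟨B, hB⟩ := exists_estLoss_mem_Icc hα hη K t
  exact ⟨B, fun ω => hB _ _ _ fun s hs => hℓ s (hs.trans_le ht) ω⟩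

lemma exists_weightedLoss_mem_Icc (hα : 0 ≤ α) (hη : ∀ t, 0 ≤ η t)
    (hℓ : ∀ t < T, ∀ ω k, ℓ t ω k ∈ Set.Icc (0 : ℝ) 1) (σ : ℕ → Ω → Equiv.Perm (Fin K))
    (j : ℕ → Ω → Fin K) (ht : t < T) :
    ∃ B, ∀ k ω, weightedLoss α η ℓ σ j t k ω ∈ Set.Icc 0 B := by
  obtain ⟨B, hB⟩ := exists_runLoss_mem_Icc hα hη hℓ σ j ht.le
  refine ⟨K * max (1 + η t * B) ((K : ℝ) ^ (1 / α)) ^ ((α + 1) / 2), fun k ω => ?_⟩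
  have hp := (exploreProb_pos (α := α) (hη t) (runLoss α η ℓ σ j t ω) (σ t ω) k).le
  obtain ⟨h0, h1⟩ := hℓ t ht ω k
  exact ⟨div_nonneg h0 hp, (div_le_div_of_nonneg_right h1 hp).trans
    (one_div_exploreProb_le hα (hη t) (hB ω) (σ t ω) k)⟩

lemma exploitProb_mem_Icc (hα : 0 < α) (η : ℕ → ℝ) (ℓ : ℕ → Ω → Fin K → ℝ)
    (σ : ℕ → Ω → Equiv.Perm (Fin K)) (j : ℕ → Ω → Fin K) (t : ℕ) (k : Fin K) (ω : Ω) :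
    exploitProb α η ℓ σ j t k ω ∈ Set.Icc (0 : ℝ) 1 :=
  have := isProbabilityMeasure_perturbLaw (Fin K) hα
  ⟨winProb_nonneg _ _, winProb_le_one _ _⟩

lemma lookaheadProb_mem_Icc (hα : 0 < α) (η : ℕ → ℝ) (ℓ : ℕ → Ω → Fin K → ℝ)
    (σ : ℕ → Ω → Equiv.Perm (Fin K)) (j : ℕ → Ω → Fin K) (t : ℕ) (k : Fin K) (ω : Ω) :
    lookaheadProb α η ℓ σ j t k ω ∈ Set.Icc (0 : ℝ) 1 :=
  have := isProbabilityMeasure_perturbLaw (Fin K) hα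
  ⟨winProb_nonneg _ _, winProb_le_one _ _⟩

lemma stability_runLoss (α : ℝ) (η : ℕ → ℝ) (ℓ : ℕ → Ω → Fin K → ℝ)
    (σ : ℕ → Ω → Equiv.Perm (Fin K)) (j : ℕ → Ω → Fin K) (t : ℕ) (ω : Ω) :
    stability α (η t) (runLoss α η ℓ σ j t ω) (σ t ω) (ℓ t ω) = ∑ k,
      (exploitProb α η ℓ σ j t k ω * ℓ t ω k - lookaheadProb α η ℓ σ j t k ω * ℓ t ω k) :=
  Finset.sum_congr rfl fun _ _ => (mul_comm _ _).trans (sub_mul _ _ _)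

variable [m : MeasurableSpace Ω] {μ : Measure Ω} {ℱ : Filtration ℕ m}

/-- The history at the beginning of round `t` together with the losses of that round. -/
abbrev lossHistory (ℱ : Filtration ℕ m) (ℓ : ℕ → Ω → Fin K → ℝ) (t : ℕ) : MeasurableSpace Ω :=
  ℱ t ⊔ MeasurableSpace.comap (ℓ t) inferInstance

lemma measurable_loss_lossHistory (ℱ : Filtration ℕ m) (ℓ : ℕ → Ω → Fin K → ℝ) (t : ℕ)
    (k : Fin K) : Measurable[lossHistory ℱ ℓ t] fun ω => ℓ t ω k :=
  (measurable_pi_apply k).comp ((comap_measurable (ℓ t)).mono le_sup_right le_rfl)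

namespace IsRun

lemma lossHistory_le (h : IsRun μ α η T ℱ ℓ r σ i j) (ht : t < T) : lossHistory ℱ ℓ t ≤ m :=
  sup_le (ℱ.le t) ((h.measurable_loss t ht).mono (ℱ.le _) le_rfl).comap_le

lemma measurable_runLoss (h : IsRun μ α η T ℱ ℓ r σ i j) (ht : t ≤ T) :
    Measurable[ℱ t] (runLoss α η ℓ σ j t) := by
  induction t with
  | zero => exact measurable_const
  | succ t ih =>
    have hle : ℱ t ≤ ℱ (t + 1) := ℱ.mono t.le_succ
    have hL : Measurable[ℱ (t + 1)] (runLoss α η ℓ σ j t) :=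
      (ih (Nat.le_of_succ_le ht)).mono hle le_rfl
    have hv : ∀ k, Measurable[ℱ (t + 1)] (weightedLoss α η ℓ σ j t k) := fun k =>
      ((measurable_pi_apply k).comp (h.measurable_loss t ht)).div
        (measurable_exploreProb α (η t) hL
          (fun k => (h.measurable_rank t ht k).mono hle le_rfl) k)
    exact measurable_add_single hL (h.measurable_explore t ht) hv

lemma measurable_runLoss_lossHistory (h : IsRun μ α η T ℱ ℓ r σ i j) (ht : t < T) :
    Measurable[lossHistory ℱ ℓ t] (runLoss α η ℓ σ j t) :=
  (h.measurable_runLoss ht.le).mono le_sup_left le_rfl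

lemma measurable_weightedLoss (h : IsRun μ α η T ℱ ℓ r σ i j) (ht : t < T) (k : Fin K) :
    Measurable[lossHistory ℱ ℓ t] (weightedLoss α η ℓ σ j t k) :=
  (measurable_loss_lossHistory ℱ ℓ t k).div
    (measurable_exploreProb α (η t) (h.measurable_runLoss_lossHistory ht)
      (fun k => (h.measurable_rank t ht k).mono le_sup_left le_rfl) k)

lemma measurable_exploitProb (h : IsRun μ α η T ℱ ℓ r σ i j) (hα : 0 < α) (ht : t < T)
    (k : Fin K) : Measurable[ℱ t] (exploitProb α η ℓ σ j t k) :=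
  have := isProbabilityMeasure_perturbLaw (Fin K) hα
  (measurable_winProb k).comp ((h.measurable_runLoss ht.le).const_smul (η t))

lemma measurable_lookaheadProb (h : IsRun μ α η T ℱ ℓ r σ i j) (hα : 0 < α) (ht : t < T)
    (k : Fin K) : Measurable[lossHistory ℱ ℓ t] (lookaheadProb α η ℓ σ j t k) :=
  have := isProbabilityMeasure_perturbLaw (Fin K) hα
  (measurable_winProb k).comp ((measurable_add_single (h.measurable_runLoss_lossHistory ht)
    measurable_const (h.measurable_weightedLoss ht)).const_smul (η t))

lemma ae_exploit_eq_iff [IsProbabilityMeasure μ] (h : IsRun μ α η T ℱ ℓ r σ i j)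
    (hα : 0 < α) (hη : ∀ t, 0 < η t) (ht : t < T) (k : Fin K) :
    ∀ᵐ ω ∂μ, i t ω = k ↔ r t ω ∈ winSet (η t • runLoss α η ℓ σ j t ω) k := by
  have := isProbabilityMeasure_paretoMeasure one_pos hα
  have hmem : ∀ ω, r t ω ∈ winSet (η t • runLoss α η ℓ σ j t ω) (i t ω) := fun ω =>
    (mem_winSet_smul_iff (hη t) _ _ _).2 (h.exploit t ht ω)
  have hties : ∀ k', k ≠ k' → ∀ᵐ ω ∂μ, r t ω ∉ winSet (η t • runLoss α η ℓ σ j t ω) k ∩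
      winSet (η t • runLoss α η ℓ σ j t ω) k' := fun k' hk =>
    ae_notMem_of_indep (P := {p | p.2 ∈ winSet p.1 k ∩ winSet p.1 k'}) (h.lossHistory_le ht)
      ((h.measurable_runLoss_lossHistory ht).const_smul (η t))
      ((h.measurable_perturbation t ht).mono (ℱ.le _) le_rfl) (h.perturbation_indep t ht)
      ((measurableSet_mem_winSet k).inter (measurableSet_mem_winSet k'))
      fun g => h.perturbation_law t ht ▸ winSet_inter_null _ g hk
  filter_upwards [ae_all_iff.2 fun k' => Filter.eventually_imp_distrib_left.2 (hties k')]
    with ω hω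
  refine ⟨fun hk => hk ▸ hmem ω, fun hk => ?_⟩
  by_contra hne
  exact hω (i t ω) (Ne.symm hne) ⟨hk, hmem ω⟩

lemma condExp_exploit [IsProbabilityMeasure μ] (h : IsRun μ α η T ℱ ℓ r σ i j)
    (hα : 0 < α) (hη : ∀ t, 0 < η t) (ht : t < T) (k : Fin K) :
    μ[{ω | i t ω = k}.indicator (fun _ => (1 : ℝ)) | lossHistory ℱ ℓ t] =ᵐ[μ]
      exploitProb α η ℓ σ j t k := by
  have hwin := condExp_indicator_mem_of_indep (P := {p | p.2 ∈ winSet p.1 k})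
    (h.lossHistory_le ht) ((h.measurable_runLoss_lossHistory ht).const_smul (η t))
    ((h.measurable_perturbation t ht).mono (ℱ.le _) le_rfl) (h.perturbation_indep t ht)
    (measurableSet_mem_winSet k)
  rw [h.perturbation_law t ht] at hwin
  refine (condExp_congr_ae ?_).trans hwin
  exact indicator_ae_eq_of_ae_eq_set
    ((h.ae_exploit_eq_iff hα hη ht k).mono fun ω hω => propext hω)

lemma integral_apply_exploit [IsProbabilityMeasure μ] (h : IsRun μ α η T ℱ ℓ r σ i j)
    (hα : 0 < α) (hη : ∀ t, 0 < η t) (ht : t < T) {f : Fin K → Ω → ℝ} {A B : ℝ}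
    (hf : ∀ k, Measurable[lossHistory ℱ ℓ t] (f k)) (hfB : ∀ k ω, f k ω ∈ Set.Icc A B) :
    ∫ ω, f (i t ω) ω ∂μ =
      ∑ k, ∫ ω, exploitProb α η ℓ σ j t k ω * f k ω ∂μ :=
  integral_apply_eq_sum_of_condExp (h.lossHistory_le ht)
    ((h.measurable_exploit t ht).mono (ℱ.le _) le_rfl) (h.condExp_exploit hα hη ht) hf hfB

lemma integral_apply_explore [IsProbabilityMeasure μ] (h : IsRun μ α η T ℱ ℓ r σ i j)
    (ht : t < T) {f : Fin K → Ω → ℝ} {A B : ℝ}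
    (hf : ∀ k, Measurable[lossHistory ℱ ℓ t] (f k)) (hfB : ∀ k ω, f k ω ∈ Set.Icc A B) :
    ∫ ω, f (j t ω) ω ∂μ =
      ∑ k, ∫ ω, exploreProb α (η t) (runLoss α η ℓ σ j t ω) (σ t ω) k * f k ω ∂μ :=
  integral_apply_eq_sum_of_condExp
    (sup_le (h.lossHistory_le ht) ((h.measurable_perturbation t ht).mono (ℱ.le _) le_rfl).comap_le)
    ((h.measurable_explore t ht).mono (ℱ.le _) le_rfl) (h.explore t ht)
    (fun k => (hf k).mono le_sup_left le_rfl) hfB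

end IsRun

end Run

section Regret

variable {K : ℕ} {Ω : Type*} {α : ℝ} {η : ℕ → ℝ} {T t : ℕ} {ℓ r : ℕ → Ω → Fin K → ℝ}
  {σ : ℕ → Ω → Equiv.Perm (Fin K)} {i j : ℕ → Ω → Fin K}

lemma sum_weightedLoss_mul_lookaheadProb_le (hα : 1 < α) (hη : ∀ t, 0 < η t)
    (hℓ : ∀ t < T, ∀ ω k, ℓ t ω k ∈ Set.Icc (0 : ℝ) 1) {β M : ℕ → ℝ} (hβ0 : β 0 = 0)
    (hβη : ∀ t, β (t + 1) = (η t)⁻¹) (hβ : Monotone β) (hM : ∀ t, 1 ≤ M t) (b : Fin K) (ω : Ω)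
    {n : ℕ} (hn : n ≤ T) :
    ∑ t ∈ Finset.range n,
        weightedLoss α η ℓ σ j t (j t ω) ω * lookaheadProb α η ℓ σ j t (j t ω) ω ≤
      potential (perturbLaw (Fin K) α) b (β n) (runLoss α η ℓ σ j n ω) +
        ∑ t ∈ Finset.range n, (β (t + 1) - β t) * (M t * (1 - exploitProb α η ℓ σ j t b ω) +
          K * (α / (α - 1) * M t ^ (1 - α))) := by
  have hP := integrable_eval_perturbLaw (ι := Fin K) hα
  have := isProbabilityMeasure_perturbLaw (Fin K) (one_pos.trans hα)
  induction n with
  | zero =>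
    have h0 : runLoss α η ℓ σ j 0 ω = 0 := rfl
    simp only [Finset.range_zero, Finset.sum_empty, hβ0, h0, potential_zero, add_zero, le_refl]
  | succ t ih =>
    obtain ⟨B, hB⟩ := exists_weightedLoss_mem_Icc (one_pos.trans hα).le (fun t => (hη t).le) hℓ σ j
      (Nat.lt_of_succ_le hn)
    have hexplore := mul_winProb_le_potential_sub hP b (j t ω) (hη t) (hB (j t ω) ω).1
      (runLoss α η ℓ σ j t ω)
    have hrate := potential_perturbLaw_sub_le hα b (hη t) ((hβ t.le_succ).trans_eq (hβη t)) (hM t)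
      (runLoss α η ℓ σ j t ω)
    rw [← runLoss_succ, ← hβη t] at hexplore
    rw [← hβη t, Fintype.card_fin] at hrate
    rw [Finset.sum_range_succ, Finset.sum_range_succ]
    have hsum := ih (Nat.le_of_succ_le hn)
    simp only [lookaheadProb, exploitProb, ← runLoss_succ] at hsum ⊢
    linarith

lemma exists_weightedLoss_mul_lookaheadProb_mem_Icc (hα : 0 < α) (hη : ∀ t, 0 ≤ η t)
    (hℓ : ∀ t < T, ∀ ω k, ℓ t ω k ∈ Set.Icc (0 : ℝ) 1) (σ : ℕ → Ω → Equiv.Perm (Fin K))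
    (j : ℕ → Ω → Fin K) (ht : t < T) :
    ∃ B, ∀ k ω, weightedLoss α η ℓ σ j t k ω * lookaheadProb α η ℓ σ j t k ω ∈ Set.Icc 0 B := by
  obtain ⟨B, hB⟩ := exists_weightedLoss_mem_Icc hα.le hη hℓ σ j ht
  refine ⟨B, fun k ω => ?_⟩
  obtain ⟨hv0, hvB⟩ := hB k ω
  obtain ⟨hw0, hw1⟩ := lookaheadProb_mem_Icc hα η ℓ σ j t k ω
  exact ⟨mul_nonneg hv0 hw0, (mul_le_of_le_one_right hv0 hw1).trans hvB⟩

variable [m : MeasurableSpace Ω] {μ : Measure Ω} {ℱ : Filtration ℕ m}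

namespace IsRun

section Integrability

variable [IsProbabilityMeasure μ]

lemma integrable_loss (h : IsRun μ α η T ℱ ℓ r σ i j)
    (hℓ : ∀ t < T, ∀ ω k, ℓ t ω k ∈ Set.Icc (0 : ℝ) 1) (ht : t < T) (k : Fin K) :
    Integrable (fun ω => ℓ t ω k) μ :=
  .of_mem_Icc 0 1 ((measurable_loss_lossHistory ℱ ℓ t k).mono
    (h.lossHistory_le ht) le_rfl).aemeasurable (ae_of_all _ fun ω => hℓ t ht ω k)

lemma integrable_loss_exploit (h : IsRun μ α η T ℱ ℓ r σ i j)
    (hℓ : ∀ t < T, ∀ ω k, ℓ t ω k ∈ Set.Icc (0 : ℝ) 1) (ht : t < T) :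
    Integrable (fun ω => ℓ t ω (i t ω)) μ :=
  integrable_apply_of_mem_Icc ((h.measurable_exploit t ht).mono (ℱ.le _) le_rfl)
    (f := fun k ω => ℓ t ω k)
    (fun k => (measurable_loss_lossHistory ℱ ℓ t k).mono (h.lossHistory_le ht) le_rfl)
    fun k ω => hℓ t ht ω k

lemma integrable_runLoss (h : IsRun μ α η T ℱ ℓ r σ i j) (hα : 0 ≤ α) (hη : ∀ t, 0 ≤ η t)
    (hℓ : ∀ t < T, ∀ ω k, ℓ t ω k ∈ Set.Icc (0 : ℝ) 1) (ht : t ≤ T) (k : Fin K) :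
    Integrable (fun ω => runLoss α η ℓ σ j t ω k) μ := by
  obtain ⟨B, hB⟩ := exists_runLoss_mem_Icc hα hη hℓ σ j ht
  exact .of_mem_Icc 0 B ((measurable_pi_apply k).comp
    ((h.measurable_runLoss ht).mono (ℱ.le _) le_rfl)).aemeasurable (ae_of_all _ fun ω => hB ω k)

lemma integrable_exploitProb (h : IsRun μ α η T ℱ ℓ r σ i j) (hα : 0 < α) (ht : t < T)
    (k : Fin K) : Integrable (exploitProb α η ℓ σ j t k) μ :=
  .of_mem_Icc 0 1 ((h.measurable_exploitProb hα ht k).mono (ℱ.le _) le_rfl).aemeasurable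
    (ae_of_all _ (exploitProb_mem_Icc hα η ℓ σ j t k))

lemma integrable_exploitProb_mul_loss (h : IsRun μ α η T ℱ ℓ r σ i j) (hα : 0 < α)
    (hℓ : ∀ t < T, ∀ ω k, ℓ t ω k ∈ Set.Icc (0 : ℝ) 1) (ht : t < T) (k : Fin K) :
    Integrable (fun ω => exploitProb α η ℓ σ j t k ω * ℓ t ω k) μ :=
  .of_mem_Icc 0 1 (((h.measurable_exploitProb hα ht k).mono (ℱ.le _) le_rfl).mul
      ((measurable_loss_lossHistory ℱ ℓ t k).mono (h.lossHistory_le ht) le_rfl)).aemeasurable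
    (ae_of_all _ fun ω =>
      unitInterval.mul_mem (exploitProb_mem_Icc hα η ℓ σ j t k ω) (hℓ t ht ω k))

lemma integrable_lookaheadProb_mul_loss (h : IsRun μ α η T ℱ ℓ r σ i j) (hα : 0 < α)
    (hℓ : ∀ t < T, ∀ ω k, ℓ t ω k ∈ Set.Icc (0 : ℝ) 1) (ht : t < T) (k : Fin K) :
    Integrable (fun ω => lookaheadProb α η ℓ σ j t k ω * ℓ t ω k) μ :=
  .of_mem_Icc 0 1 (((h.measurable_lookaheadProb hα ht k).mul
      (measurable_loss_lossHistory ℱ ℓ t k)).mono (h.lossHistory_le ht) le_rfl).aemeasurable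
    (ae_of_all _ fun ω =>
      unitInterval.mul_mem (lookaheadProb_mem_Icc hα η ℓ σ j t k ω) (hℓ t ht ω k))

lemma integrable_stability (h : IsRun μ α η T ℱ ℓ r σ i j) (hα : 0 < α)
    (hℓ : ∀ t < T, ∀ ω k, ℓ t ω k ∈ Set.Icc (0 : ℝ) 1) (ht : t < T) :
    Integrable (fun ω => stability α (η t) (runLoss α η ℓ σ j t ω) (σ t ω) (ℓ t ω)) μ := by
  simp only [stability_runLoss]
  exact integrable_finsetSum _ fun k _ => (h.integrable_exploitProb_mul_loss hα hℓ ht k).sub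
    (h.integrable_lookaheadProb_mul_loss hα hℓ ht k)

lemma integrable_weightedLoss_mul_lookaheadProb (h : IsRun μ α η T ℱ ℓ r σ i j) (hα : 0 < α)
    (hη : ∀ t, 0 ≤ η t) (hℓ : ∀ t < T, ∀ ω k, ℓ t ω k ∈ Set.Icc (0 : ℝ) 1) (ht : t < T) :
    Integrable (fun ω => weightedLoss α η ℓ σ j t (j t ω) ω *
      lookaheadProb α η ℓ σ j t (j t ω) ω) μ := by
  obtain ⟨B, hB⟩ := exists_weightedLoss_mul_lookaheadProb_mem_Icc hα hη hℓ σ j ht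
  exact integrable_apply_of_mem_Icc ((h.measurable_explore t ht).mono (ℱ.le _) le_rfl)
    (f := fun k ω => weightedLoss α η ℓ σ j t k ω * lookaheadProb α η ℓ σ j t k ω)
    (fun k => ((h.measurable_weightedLoss ht k).mul (h.measurable_lookaheadProb hα ht k)).mono
      (h.lossHistory_le ht) le_rfl) hB

end Integrability

variable [IsProbabilityMeasure μ]

lemma integral_loss_exploit (h : IsRun μ α η T ℱ ℓ r σ i j) (hα : 0 < α) (hη : ∀ t, 0 < η t)
    (hℓ : ∀ t < T, ∀ ω k, ℓ t ω k ∈ Set.Icc (0 : ℝ) 1) (ht : t < T) :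
    ∫ ω, ℓ t ω (i t ω) ∂μ = ∑ k, ∫ ω, exploitProb α η ℓ σ j t k ω * ℓ t ω k ∂μ :=
  h.integral_apply_exploit hα hη ht (f := fun k ω => ℓ t ω k)
    (measurable_loss_lossHistory ℱ ℓ t) fun k ω => hℓ t ht ω k

lemma integral_weightedLoss_mul_lookaheadProb (h : IsRun μ α η T ℱ ℓ r σ i j) (hα : 0 < α)
    (hη : ∀ t, 0 ≤ η t) (hℓ : ∀ t < T, ∀ ω k, ℓ t ω k ∈ Set.Icc (0 : ℝ) 1) (ht : t < T) :
    ∫ ω, weightedLoss α η ℓ σ j t (j t ω) ω * lookaheadProb α η ℓ σ j t (j t ω) ω ∂μ =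
      ∑ k, ∫ ω, lookaheadProb α η ℓ σ j t k ω * ℓ t ω k ∂μ := by
  obtain ⟨B, hB⟩ := exists_weightedLoss_mul_lookaheadProb_mem_Icc hα hη hℓ σ j ht
  rw [h.integral_apply_explore ht
    (f := fun k ω => weightedLoss α η ℓ σ j t k ω * lookaheadProb α η ℓ σ j t k ω)
    (fun k => (h.measurable_weightedLoss ht k).mul (h.measurable_lookaheadProb hα ht k))
    hB]
  refine Finset.sum_congr rfl fun k _ => integral_congr_ae (ae_of_all _ fun ω => ?_)
  simp only [← mul_assoc, exploreProb_mul_weightedLoss hη]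
  exact mul_comm _ _

lemma integral_loss_exploit_eq_stability_add (h : IsRun μ α η T ℱ ℓ r σ i j) (hα : 0 < α)
    (hη : ∀ t, 0 < η t) (hℓ : ∀ t < T, ∀ ω k, ℓ t ω k ∈ Set.Icc (0 : ℝ) 1) (ht : t < T) :
    ∫ ω, ℓ t ω (i t ω) ∂μ =
      (∫ ω, stability α (η t) (runLoss α η ℓ σ j t ω) (σ t ω) (ℓ t ω) ∂μ) +
        ∫ ω, weightedLoss α η ℓ σ j t (j t ω) ω * lookaheadProb α η ℓ σ j t (j t ω) ω ∂μ := by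
  have hw := h.integrable_exploitProb_mul_loss hα hℓ ht
  have hv := h.integrable_lookaheadProb_mul_loss hα hℓ ht
  rw [h.integral_loss_exploit hα hη hℓ ht,
    h.integral_weightedLoss_mul_lookaheadProb hα (fun t => (hη t).le) hℓ ht]
  simp only [stability_runLoss]
  rw [integral_finsetSum _ fun k _ => (hw k).sub' (hv k), ← Finset.sum_add_distrib]
  exact Finset.sum_congr rfl fun k _ => by rw [integral_sub (hw k) (hv k), sub_add_cancel]

lemma integral_single_weightedLoss (h : IsRun μ α η T ℱ ℓ r σ i j) (hα : 0 ≤ α)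
    (hη : ∀ t, 0 ≤ η t) (hℓ : ∀ t < T, ∀ ω k, ℓ t ω k ∈ Set.Icc (0 : ℝ) 1) (ht : t < T)
    (b : Fin K) :
    ∫ ω, (Pi.single (j t ω) (weightedLoss α η ℓ σ j t (j t ω) ω) : Fin K → ℝ) b ∂μ =
      ∫ ω, ℓ t ω b ∂μ := by
  obtain ⟨B, hB⟩ := exists_weightedLoss_mem_Icc hα hη hℓ σ j ht
  rw [h.integral_apply_explore ht (A := 0) (B := B)
    (f := fun k ω => (Pi.single k (weightedLoss α η ℓ σ j t k ω) : Fin K → ℝ) b)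
    (fun k => ?_) fun k ω => ?_, Finset.sum_eq_single b (fun k _ hk => ?_) (by simp)]
  · simp only [Pi.single_eq_same, exploreProb_mul_weightedLoss hη]
  · simp only [Pi.single_eq_of_ne hk.symm, mul_zero, integral_zero]
  all_goals obtain rfl | hk := eq_or_ne k b
  · simpa only [Pi.single_eq_same] using h.measurable_weightedLoss ht k
  · simpa only [Pi.single_eq_of_ne hk.symm] using measurable_const
  · simpa only [Pi.single_eq_same] using hB k ω
  · simpa only [Pi.single_eq_of_ne hk.symm] using
      Set.left_mem_Icc.2 ((hB k ω).1.trans (hB k ω).2)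

lemma integral_runLoss (h : IsRun μ α η T ℱ ℓ r σ i j) (hα : 0 ≤ α) (hη : ∀ t, 0 ≤ η t)
    (hℓ : ∀ t < T, ∀ ω k, ℓ t ω k ∈ Set.Icc (0 : ℝ) 1) (b : Fin K) {n : ℕ} (hn : n ≤ T) :
    ∫ ω, runLoss α η ℓ σ j n ω b ∂μ = ∑ t ∈ Finset.range n, ∫ ω, ℓ t ω b ∂μ := by
  induction n with
  | zero => simp [runLoss, estLoss]
  | succ t ih =>
    have ht : t < T := hn
    have hsub : ∀ ω, (Pi.single (j t ω) (weightedLoss α η ℓ σ j t (j t ω) ω) : Fin K → ℝ) b =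
        runLoss α η ℓ σ j (t + 1) ω b - runLoss α η ℓ σ j t ω b := fun ω => by
      simp only [runLoss_succ, Pi.add_apply, add_sub_cancel_left]
    have hincr := h.integral_single_weightedLoss hα hη hℓ ht b
    simp only [hsub] at hincr
    rw [integral_sub (h.integrable_runLoss hα hη hℓ hn b)
      (h.integrable_runLoss hα hη hℓ ht.le b), ih ht.le] at hincr
    rw [Finset.sum_range_succ, ← hincr, add_sub_cancel]

lemma sum_integral_loss_sub_le (h : IsRun μ α η T ℱ ℓ r σ i j) (hα : 1 < α)
    (hη : ∀ t, 0 < η t) (hℓ : ∀ t < T, ∀ ω k, ℓ t ω k ∈ Set.Icc (0 : ℝ) 1) {β M : ℕ → ℝ}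
    (hβ0 : β 0 = 0) (hβη : ∀ t, β (t + 1) = (η t)⁻¹) (hβ : Monotone β) (hM : ∀ t, 1 ≤ M t)
    (b : Fin K) :
    ∑ t ∈ Finset.range T, ((∫ ω, ℓ t ω (i t ω) ∂μ) - ∫ ω, ℓ t ω b ∂μ) ≤
      ∑ t ∈ Finset.range T, ∫ ω,
        (stability α (η t) (runLoss α η ℓ σ j t ω) (σ t ω) (ℓ t ω) +
          (β (t + 1) - β t) * (M t * (1 - exploitProb α η ℓ σ j t b ω) +
            K * (α / (α - 1) * M t ^ (1 - α)))) ∂μ := by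
  have hα0 := one_pos.trans hα
  have := isProbabilityMeasure_perturbLaw (Fin K) hα0
  have hη0 : ∀ t, 0 ≤ η t := fun t => (hη t).le
  have hpen : ∀ t ∈ Finset.range T, Integrable (fun ω => (β (t + 1) - β t) *
      (M t * (1 - exploitProb α η ℓ σ j t b ω) + K * (α / (α - 1) * M t ^ (1 - α)))) μ :=
    fun t ht => ((((integrable_const _).sub (h.integrable_exploitProb hα0 (Finset.mem_range.1 ht)
      b)).const_mul _).add (integrable_const _)).const_mul _
  have hv : ∀ t ∈ Finset.range T, Integrable (fun ω => weightedLoss α η ℓ σ j t (j t ω) ω *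
      lookaheadProb α η ℓ σ j t (j t ω) ω) μ := fun t ht =>
    h.integrable_weightedLoss_mul_lookaheadProb hα0 hη0 hℓ (Finset.mem_range.1 ht)
  have hL := h.integrable_runLoss hα0.le hη0 hℓ le_rfl b
  have hpath := integral_mono (integrable_finsetSum _ hv)
    (hL.add (integrable_finsetSum _ hpen)) fun ω =>
      (sum_weightedLoss_mul_lookaheadProb_le hα hη hℓ hβ0 hβη hβ hM b ω le_rfl).trans
        (add_le_add_left (potential_le (integrable_eval_perturbLaw hα) b _ _) _)
  rw [integral_add' hL (integrable_finsetSum _ hpen), integral_finsetSum _ hv,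
    integral_finsetSum _ hpen, h.integral_runLoss hα0.le hη0 hℓ b le_rfl] at hpath
  rw [Finset.sum_sub_distrib, Finset.sum_congr rfl fun t ht =>
      h.integral_loss_exploit_eq_stability_add hα0 hη hℓ (Finset.mem_range.1 ht),
    Finset.sum_congr rfl fun t ht => integral_add
      (h.integrable_stability hα0 hℓ (Finset.mem_range.1 ht)) (hpen t ht),
    Finset.sum_add_distrib, Finset.sum_add_distrib]
  linarith

end IsRun

end Regret

section Gap

variable {K : ℕ} {Ω : Type*} [m : MeasurableSpace Ω] {μ : Measure Ω}
  {ℱ : Filtration ℕ m} {α : ℝ} {η : ℕ → ℝ} {T t : ℕ} {ℓ r : ℕ → Ω → Fin K → ℝ}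
  {σ : ℕ → Ω → Equiv.Perm (Fin K)} {i j : ℕ → Ω → Fin K} {b k : Fin K} {D : ℝ}

/-- The losses lie in `[0, 1]`, and whatever happened before a round, the conditional expected loss
of every other arm in that round exceeds that of the arm `b` by at least `D`. Compared with the
stochastically constrained adversarial regime, the gaps may vary with the round and the history. -/
structure HasGap (μ : Measure Ω) (T : ℕ) (ℱ : Filtration ℕ m) (ℓ : ℕ → Ω → Fin K → ℝ) (b : Fin K)
    (D : ℝ) : Prop where
  loss_mem : ∀ t < T, ∀ ω k, ℓ t ω k ∈ Set.Icc (0 : ℝ) 1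
  gap : ∀ t < T, ∀ k, k ≠ b → ∀ᵐ ω ∂μ, D ≤ (μ[fun ω => ℓ t ω k - ℓ t ω b | ℱ t]) ω

lemma minGap_le (Δ : Fin K → Fin K → ℝ) (hk : k ≠ b) : minGap Δ b ≤ Δ k b :=
  ciInf_le_of_finite (fun k : {k : Fin K // k ≠ b} => Δ k b) ⟨k, hk⟩

lemma minGap_pos [Nontrivial (Fin K)] {Δ : Fin K → Fin K → ℝ} (hΔ : ∀ k, k ≠ b → 0 < Δ k b) :
    0 < minGap Δ b := by
  obtain ⟨k, hk⟩ := exists_ne b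
  have : Nonempty {k : Fin K // k ≠ b} := ⟨⟨k, hk⟩⟩
  obtain ⟨k, hk⟩ := exists_eq_ciInf_of_finite (f := fun k : {k : Fin K // k ≠ b} => Δ k b)
  rw [minGap, ← hk]
  exact hΔ k k.2

lemma IsSCA.hasGap {Δ : Fin K → Fin K → ℝ} (hs : IsSCA μ T ℱ ℓ Δ) (b : Fin K) :
    HasGap μ T ℱ ℓ b (minGap Δ b) where
  loss_mem := hs.loss_mem
  gap t ht k hk := (hs.gap t ht k b).mono fun _ hω => (minGap_le Δ hk).trans_eq hω.symm

namespace HasGap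

lemma loss_sub_mem (hg : HasGap μ T ℱ ℓ b D) (ht : t < T) (k : Fin K) (ω : Ω) :
    ℓ t ω k - ℓ t ω b ∈ Set.Icc (-1 : ℝ) 1 := by
  obtain ⟨hk0, hk1⟩ := hg.loss_mem t ht ω k
  obtain ⟨hb0, hb1⟩ := hg.loss_mem t ht ω b
  exact ⟨by linarith, by linarith⟩

variable [IsProbabilityMeasure μ]

lemma le_integral_sub (hg : HasGap μ T ℱ ℓ b D) (ht : t < T) (hk : k ≠ b) :
    D ≤ ∫ ω, (ℓ t ω k - ℓ t ω b) ∂μ := by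
  rw [← integral_condExp (ℱ.le t)]
  calc D = ∫ _, D ∂μ := by simp
    _ ≤ _ := integral_mono_ae (integrable_const _) integrable_condExp (hg.gap t ht k hk)

lemma le_one [Nontrivial (Fin K)] (hg : HasGap μ T ℱ ℓ b D) (hT : 0 < T) : D ≤ 1 := by
  obtain ⟨k, hk⟩ := exists_ne b
  have hnorm : ∀ ω, ‖ℓ 0 ω k - ℓ 0 ω b‖ ≤ 1 := fun ω =>
    abs_sub_le_of_le_of_le (hg.loss_mem 0 hT ω k).1 (hg.loss_mem 0 hT ω k).2
      (hg.loss_mem 0 hT ω b).1 (hg.loss_mem 0 hT ω b).2 |>.trans_eq (sub_zero 1)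
  calc D ≤ ∫ ω, (ℓ 0 ω k - ℓ 0 ω b) ∂μ := hg.le_integral_sub hT hk
    _ ≤ ‖∫ ω, (ℓ 0 ω k - ℓ 0 ω b) ∂μ‖ := le_abs_self _
    _ ≤ 1 := by simpa using norm_integral_le_of_norm_le_const (μ := μ) (ae_of_all _ hnorm)

lemma mul_integral_exploitProb_le (hg : HasGap μ T ℱ ℓ b D) (h : IsRun μ α η T ℱ ℓ r σ i j)
    (hα : 0 < α) (ht : t < T) (hk : k ≠ b) :
    D * ∫ ω, exploitProb α η ℓ σ j t k ω ∂μ ≤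
      ∫ ω, exploitProb α η ℓ σ j t k ω * (ℓ t ω k - ℓ t ω b) ∂μ := by
  have hw := exploitProb_mem_Icc hα η ℓ σ j t k
  have hint : Integrable (fun ω => ℓ t ω k - ℓ t ω b) μ :=
    (h.integrable_loss hg.loss_mem ht k).sub (h.integrable_loss hg.loss_mem ht b)
  have hmul : Integrable (fun ω => (μ[fun ω => ℓ t ω k - ℓ t ω b | ℱ t]) ω *
      exploitProb α η ℓ σ j t k ω) μ :=
    integrable_condExp.mul_bdd (c := 1) (h.integrable_exploitProb hα ht k).aestronglyMeasurable
      (ae_of_all _ fun ω => (abs_of_nonneg (hw ω).1).trans_le (hw ω).2)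
  simp only [mul_comm (exploitProb α η ℓ σ j t k _)]
  rw [integral_mul_eq_of_condExp_ae_eq (ℱ.le t) hint Filter.EventuallyEq.rfl
    (h.measurable_exploitProb hα ht k) hw, ← integral_const_mul]
  exact integral_mono_ae ((h.integrable_exploitProb hα ht k).const_mul D) hmul
    ((hg.gap t ht k hk).mono fun ω hω => mul_le_mul_of_nonneg_right hω (hw ω).1)

lemma mul_integral_one_sub_exploitProb_le (hg : HasGap μ T ℱ ℓ b D)
    (h : IsRun μ α η T ℱ ℓ r σ i j) (hα : 0 < α) (hη : ∀ t, 0 < η t) (ht : t < T) :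
    D * ∫ ω, (1 - exploitProb α η ℓ σ j t b ω) ∂μ ≤
      (∫ ω, ℓ t ω (i t ω) ∂μ) - ∫ ω, ℓ t ω b ∂μ := by
  have hone : 1 = ∑ k, ∫ ω, exploitProb α η ℓ σ j t k ω ∂μ := by
    simpa using h.integral_apply_exploit hα hη ht (f := fun _ _ => 1) (A := 1) (B := 1)
      (fun _ => measurable_const) (by simp)
  have hregret := h.integral_apply_exploit hα hη ht (f := fun k ω => ℓ t ω k - ℓ t ω b)
    (fun k => (measurable_loss_lossHistory ℱ ℓ t k).sub (measurable_loss_lossHistory ℱ ℓ t b))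
    (hg.loss_sub_mem ht)
  rw [integral_sub (h.integrable_loss_exploit hg.loss_mem ht)
    (h.integrable_loss hg.loss_mem ht b), ← Finset.add_sum_erase _ _ (Finset.mem_univ b)] at hregret
  rw [← Finset.add_sum_erase _ _ (Finset.mem_univ b), ← sub_eq_iff_eq_add'] at hone
  rw [hregret, integral_sub (integrable_const _) (h.integrable_exploitProb hα ht b),
    integral_const, probReal_univ, one_smul, hone, Finset.mul_sum]
  simp only [sub_self, mul_zero, integral_zero, zero_add]
  exact Finset.sum_le_sum fun k hk =>
    hg.mul_integral_exploitProb_le h hα ht (Finset.ne_of_mem_erase hk)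

lemma pseudoRegret_le (hg : HasGap μ T ℱ ℓ b D) (hD : 0 ≤ D) (h : IsRun μ α η T ℱ ℓ r σ i j) :
    pseudoRegret μ T ℓ i ≤
      ∑ t ∈ Finset.range T, ((∫ ω, ℓ t ω (i t ω) ∂μ) - ∫ ω, ℓ t ω b ∂μ) := by
  have : Nonempty (Fin K) := ⟨b⟩
  have hint : ∀ k, ∀ t ∈ Finset.range T, Integrable (fun ω => ℓ t ω k) μ := fun k t ht =>
    h.integrable_loss hg.loss_mem (Finset.mem_range.1 ht) k
  rw [pseudoRegret, Finset.sum_sub_distrib, integral_finsetSum _ fun t ht =>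
    h.integrable_loss_exploit hg.loss_mem (Finset.mem_range.1 ht)]
  refine sub_le_sub_left (le_ciInf fun k => ?_) _
  rw [integral_finsetSum _ (hint k)]
  refine Finset.sum_le_sum fun t ht => ?_
  obtain rfl | hk := eq_or_ne k b
  · exact le_rfl
  · rw [← sub_nonneg, ← integral_sub (hint k t ht) (hint b t ht)]
    exact hD.trans (hg.le_integral_sub (Finset.mem_range.1 ht) hk)

/-- The self-bounding argument: if the round costs are at most `D / 2 * (1 - exploitProb b)` plus
`Q t`, the former terms add up to at most half of the regret itself. -/
lemma pseudoRegret_le_two_mul_sum (hg : HasGap μ T ℱ ℓ b D) (hD : 0 ≤ D)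
    (h : IsRun μ α η T ℱ ℓ r σ i j) (hα : 1 < α) (hη : ∀ t, 0 < η t) {β M Q : ℕ → ℝ}
    (hβ0 : β 0 = 0) (hβη : ∀ t, β (t + 1) = (η t)⁻¹) (hβ : Monotone β) (hM : ∀ t, 1 ≤ M t)
    (hcost : ∀ t < T, ∀ ω, stability α (η t) (runLoss α η ℓ σ j t ω) (σ t ω) (ℓ t ω) +
        (β (t + 1) - β t) * (M t * (1 - exploitProb α η ℓ σ j t b ω) +
          K * (α / (α - 1) * M t ^ (1 - α))) ≤
      D / 2 * (1 - exploitProb α η ℓ σ j t b ω) + Q t) :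
    pseudoRegret μ T ℓ i ≤ 2 * ∑ t ∈ Finset.range T, Q t := by
  have hα0 := one_pos.trans hα
  have hround : ∀ t ∈ Finset.range T, ∫ ω,
      (stability α (η t) (runLoss α η ℓ σ j t ω) (σ t ω) (ℓ t ω) +
        (β (t + 1) - β t) * (M t * (1 - exploitProb α η ℓ σ j t b ω) +
          K * (α / (α - 1) * M t ^ (1 - α)))) ∂μ ≤
      ((∫ ω, ℓ t ω (i t ω) ∂μ) - ∫ ω, ℓ t ω b ∂μ) / 2 + Q t := fun t ht => by
    have ht := Finset.mem_range.1 ht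
    have hw : Integrable (fun ω => 1 - exploitProb α η ℓ σ j t b ω) μ :=
      (integrable_const _).sub (h.integrable_exploitProb hα0 ht b)
    refine (integral_mono ((h.integrable_stability hα0 hg.loss_mem ht).add
      (((hw.const_mul _).add (integrable_const _)).const_mul _))
      ((hw.const_mul _).add (integrable_const _)) (hcost t ht)).trans ?_
    rw [integral_add' (hw.const_mul _) (integrable_const _), integral_const_mul, integral_const,
      probReal_univ, one_smul]
    linarith [hg.mul_integral_one_sub_exploitProb_le h hα0 hη ht]
  have hsum := (h.sum_integral_loss_sub_le hα hη hg.loss_mem hβ0 hβη hβ hM b).trans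
    (Finset.sum_le_sum hround)
  rw [Finset.sum_add_distrib, ← Finset.sum_div] at hsum
  linarith [hg.pseudoRegret_le hD h]

end HasGap

end Gap

section SqrtSums

lemma sqrt_succ_sub_sqrt_mul (t : ℕ) :
    (√((t : ℝ) + 1) - √(t : ℝ)) * (√((t : ℝ) + 1) + √(t : ℝ)) = 1 := by
  rw [mul_comm, ← sq_sub_sq, Real.sq_sqrt t.cast_add_one_pos.le, Real.sq_sqrt t.cast_nonneg]
  ring

lemma sqrt_le_sqrt_succ (t : ℕ) : √(t : ℝ) ≤ √((t : ℝ) + 1) :=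
  Real.sqrt_le_sqrt (le_add_of_nonneg_right zero_le_one)

lemma sqrt_succ_pos (t : ℕ) : 0 < √((t : ℝ) + 1) :=
  Real.sqrt_pos.2 t.cast_add_one_pos

lemma sqrt_succ_sub_sqrt_le (t : ℕ) : √((t : ℝ) + 1) - √(t : ℝ) ≤ 1 / √((t : ℝ) + 1) := by
  rw [le_div_iff₀ (sqrt_succ_pos t)]
  exact (mul_le_mul_of_nonneg_left (le_add_of_nonneg_right (Real.sqrt_nonneg _))
    (sub_nonneg.2 (sqrt_le_sqrt_succ t))).trans_eq (sqrt_succ_sub_sqrt_mul t)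

lemma one_div_sqrt_succ_le (t : ℕ) : 1 / √((t : ℝ) + 1) ≤ 2 * (√((t : ℝ) + 1) - √(t : ℝ)) := by
  rw [div_le_iff₀ (sqrt_succ_pos t)]
  nlinarith [sqrt_succ_sub_sqrt_mul t, sqrt_le_sqrt_succ t]

lemma one_div_sqrt_succ_pow_three_le (t : ℕ) :
    1 / √((t : ℝ) + 1) ^ 3 ≤ 4 * (1 / √((t : ℝ) + 1) - 1 / √(((t + 1 : ℕ) : ℝ) + 1)) := by
  have hdiff := sqrt_succ_sub_sqrt_mul (t + 1)
  have hle := sqrt_le_sqrt_succ (t + 1)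
  rw [Nat.cast_succ] at hdiff hle ⊢
  have hu := sqrt_succ_pos t
  have husq := Real.sq_sqrt (t.cast_add_one_pos (α := ℝ)).le
  have hvsq := Real.sq_sqrt ((t + 1).cast_add_one_pos (α := ℝ)).le
  rw [Nat.cast_succ] at hvsq
  generalize √((t : ℝ) + 1) = u at *
  generalize √((t : ℝ) + 1 + 1) = v at *
  have hv : 0 < v := hu.trans_le hle
  have hvu : v * (v + u) ≤ 4 * u ^ 2 := by
    nlinarith [t.cast_nonneg (α := ℝ)]
  calc 1 / u ^ 3 = 4 / (u * (4 * u ^ 2)) := by field_simp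
    _ ≤ 4 / (u * (v * (v + u))) := by gcongr
    _ = 4 * ((v - u) * (v + u)) / (u * (v * (v + u))) := by rw [hdiff, mul_one]
    _ = 4 * (1 / u - 1 / v) := by field_simp

lemma sum_ite_sqrt_succ_lt_le {A E N : ℝ} (hA : 0 ≤ A) (hE : 0 ≤ E) (hN : 0 < N) (n : ℕ) :
    ∑ t ∈ Finset.range n, (if √((t : ℝ) + 1) < N then A / √((t : ℝ) + 1)
      else E / √((t : ℝ) + 1) ^ 3) ≤ 2 * A * N + 4 * E / N := by
  set φ : ℕ → ℝ := fun t => A * (2 * min N √(t : ℝ)) - E * (4 * min (1 / N) (1 / √((t : ℝ) + 1)))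
    with hφ
  have hstep : ∀ t : ℕ, (if √((t : ℝ) + 1) < N then A / √((t : ℝ) + 1)
      else E / √((t : ℝ) + 1) ^ 3) ≤ φ (t + 1) - φ t := fun t => by
    have hu := sqrt_succ_pos t
    have hsqrt := sqrt_le_sqrt_succ t
    have hinv : 1 / √(((t + 1 : ℕ) : ℝ) + 1) ≤ 1 / √((t : ℝ) + 1) :=
      one_div_le_one_div_of_le hu (Nat.cast_succ (R := ℝ) t ▸ sqrt_le_sqrt_succ (t + 1))
    have hA' : 0 ≤ A * (2 * min N √((t : ℝ) + 1) - 2 * min N √(t : ℝ)) :=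
      mul_nonneg hA (by linarith [min_le_min_left N hsqrt])
    have hE' : 0 ≤ E * (4 * min (1 / N) (1 / √((t : ℝ) + 1)) -
        4 * min (1 / N) (1 / √(((t + 1 : ℕ) : ℝ) + 1))) :=
      mul_nonneg hE (by linarith [min_le_min_left (1 / N) hinv])
    simp only [hφ, Nat.cast_succ] at hE' hinv ⊢
    split_ifs with h
    · rw [min_eq_right h.le, min_eq_right (hsqrt.trans h.le)] at *
      have := mul_le_mul_of_nonneg_left (one_div_sqrt_succ_le t) hA
      rw [mul_one_div] at this
      linarith
    · have hN1 := one_div_le_one_div_of_le hN (not_lt.1 h)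
      rw [min_eq_right hN1, min_eq_right (hinv.trans hN1)] at *
      have := mul_le_mul_of_nonneg_left (one_div_sqrt_succ_pow_three_le t) hE
      rw [mul_one_div, Nat.cast_succ] at this
      linarith
  calc _ ≤ ∑ t ∈ Finset.range n, (φ (t + 1) - φ t) := Finset.sum_le_sum fun t _ => hstep t
    _ = φ n - φ 0 := Finset.sum_range_sub φ n
    _ ≤ A * (2 * N) - 0 - (A * (2 * 0) - E * (4 * (1 / N))) := by
      simp only [hφ, Nat.cast_zero, Real.sqrt_zero, min_eq_right hN.le]
      gcongr
      · exact min_le_left _ _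
      · positivity
      · exact min_le_left _ _
    _ = 2 * A * N + 4 * E / N := by ring

end SqrtSums

section Tuning

/-- The factor `A` for which a round costs at most `A * K ^ (1 / 6) / √t` times the size of its
truncated penalty, given the learning-rate constant `c`. -/
def costConst (c : ℝ) : ℝ := 1089 * c + 5 / (2 * c)

/-- The constant of the regret bound for the learning-rate constant `c`. -/
def regretConst (c : ℝ) : ℝ :=
  4 * costConst c * (2 * costConst c + 6 * c) + 32 * costConst c ^ 3 / (2 * costConst c + 6 * c)

/-- The threshold on `√t` that separates the early rounds, whose costs are bounded in the worst
case, from the late ones, whose costs are absorbed in the regret. The argument `κ` stands for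
`K ^ (1 / 6)`. -/
def lateStart (c κ D : ℝ) : ℝ := (2 * costConst c + 6 * c) * κ ^ 3 / D

/-- The truncation level of the penalty in the round with `u = √t`. In a late round it makes the
coefficient of `1 - exploitProb` in the cost equal to `D / 2`. -/
def truncation (c κ D u : ℝ) : ℝ :=
  if u < lateStart c κ D then κ ^ 2 else D * u / (2 * costConst c * κ)

/-- The part of the cost of the round with `u = √t` that is not absorbed in the regret. -/
def residualCost (c κ D u : ℝ) : ℝ :=
  if u < lateStart c κ D then costConst c * κ ^ 3 / u
  else 4 * costConst c ^ 3 * κ ^ 9 / D ^ 2 / u ^ 3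

variable {K : ℕ} {c κ D u δ : ℝ} {L ℓ : Fin K → ℝ} {σ : Equiv.Perm (Fin K)}

lemma costConst_pos (hc : 0 < c) : 0 < costConst c := by
  rw [costConst]
  positivity

lemma regretConst_pos (hc : 0 < c) : 0 < regretConst c := by
  have := costConst_pos hc
  rw [regretConst]
  positivity

lemma lateStart_pos (hc : 0 < c) (hκ : 0 < κ) (hD : 0 < D) : 0 < lateStart c κ D := by
  have := costConst_pos hc
  rw [lateStart]
  positivity

lemma le_of_lateStart_le (hc : 0 < c) (hκ : 1 ≤ κ) (hD : 0 < D) (h : lateStart c κ D ≤ u) :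
    2 * costConst c * κ + 6 * c * κ ≤ D * u := by
  have := costConst_pos hc
  rw [lateStart, div_le_iff₀ hD] at h
  calc 2 * costConst c * κ + 6 * c * κ = (2 * costConst c + 6 * c) * κ := by ring
    _ ≤ (2 * costConst c + 6 * c) * κ ^ 3 := by
      gcongr
      exact le_self_pow₀ hκ three_ne_zero
    _ ≤ D * u := h.trans_eq (mul_comm u D)

lemma one_le_truncation (hc : 0 < c) (hκ : 1 ≤ κ) (hD : 0 < D) : 1 ≤ truncation c κ D u := by
  have := costConst_pos hc
  have hκ0 := one_pos.trans_le hκ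
  rw [truncation]
  split_ifs with h
  · exact one_le_pow₀ hκ
  · rw [one_le_div (by positivity)]
    linarith [le_of_lateStart_le hc hκ hD (not_lt.1 h), mul_pos hc hκ0]

lemma cost_le {s Y Z : ℝ} (hc : 0 < c) (hκ : 0 < κ) (hu : 0 < u)
    (hs : s ≤ 1089 * (c / (κ * u)) * κ ^ 2 * Y) (hδ : δ ≤ κ / c * (1 / u)) (hZ : 0 ≤ Z)
    (hZY : Z ≤ 5 / 2 * Y) : s + δ * Z ≤ costConst c * κ / u * Y :=
  calc s + δ * Z ≤ 1089 * (c / (κ * u)) * κ ^ 2 * Y + κ / c * (1 / u) * (5 / 2 * Y) := by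
        gcongr
    _ = costConst c * κ / u * Y := by
        rw [costConst]
        field_simp

lemma two_mul_sum_residualCost_le (hc : 0 < c) (hκ : 0 < κ) (hD : 0 < D) (n : ℕ) :
    2 * ∑ t ∈ Finset.range n, residualCost c κ D √((t : ℝ) + 1) ≤
      regretConst c * (κ ^ 6 / D) := by
  have hA := costConst_pos hc
  calc _ ≤ 2 * (2 * (costConst c * κ ^ 3) * lateStart c κ D +
        4 * (4 * costConst c ^ 3 * κ ^ 9 / D ^ 2) / lateStart c κ D) :=
        mul_le_mul_of_nonneg_left (sum_ite_sqrt_succ_lt_le (by positivity) (by positivity)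
          (lateStart_pos hc hκ hD) n) zero_le_two
    _ = regretConst c * (κ ^ 6 / D) := by
        rw [regretConst, lateStart]
        field_simp
        ring

variable [Nontrivial (Fin K)]

lemma cost_le_of_lt_lateStart (hc : 0 < c) (hκ : 0 < κ) (hκK : κ ^ 6 = K) (hD : 0 ≤ D) (hu : 0 < u)
    (h : u < lateStart c κ D) (hσ : IsRanking L σ) (hℓ : ∀ k, ℓ k ∈ Set.Icc (0 : ℝ) 1)
    (hδ : δ ≤ κ / c * (1 / u)) {x : ℝ} (hx : x ∈ Set.Icc (0 : ℝ) 1) :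
    stability 3 (c / (κ * u)) L σ ℓ +
        δ * (truncation c κ D u * x + K * (3 / 2 / truncation c κ D u ^ 2)) ≤
      D / 2 * x + residualCost c κ D u := by
  obtain ⟨hx0, hx1⟩ := hx
  have hη : 0 < c / (κ * u) := by positivity
  have hstab : stability 3 (c / (κ * u)) L σ ℓ ≤ 1089 * (c / (κ * u)) * κ ^ 2 * κ ^ 2 :=
    calc _ ≤ 81 * (c / (κ * u)) * (κ ^ 2) ^ 2 :=
          stability_three_le_sq hη.le hσ hℓ (sq_nonneg κ) (by rw [← hκK]; ring)
      _ ≤ 1089 * (c / (κ * u)) * (κ ^ 2) ^ 2 := by gcongr; norm_num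
      _ = _ := by ring
  have hpenalty : κ ^ 2 * x + K * (3 / 2 / (κ ^ 2) ^ 2) = κ ^ 2 * (x + 3 / 2) := by
    rw [← hκK]
    field_simp
  rw [truncation, residualCost, if_pos h, if_pos h, hpenalty]
  calc _ ≤ costConst c * κ / u * κ ^ 2 :=
        cost_le hc hκ hu hstab hδ (by positivity) (by nlinarith [sq_nonneg κ])
    _ = costConst c * κ ^ 3 / u := by ring
    _ ≤ D / 2 * x + costConst c * κ ^ 3 / u := le_add_of_nonneg_left (by positivity)

lemma cost_le_of_lateStart_le (hc : 0 < c) (hκ : 1 ≤ κ) (hκK : κ ^ 6 = K) (hD : 0 < D) (hD1 : D ≤ 1)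
    (hu : 0 < u) (h : lateStart c κ D ≤ u) (hσ : IsRanking L σ)
    (hℓ : ∀ k, ℓ k ∈ Set.Icc (0 : ℝ) 1) (hδ : δ ≤ κ / c * (1 / u)) (b : Fin K) :
    stability 3 (c / (κ * u)) L σ ℓ +
        δ * (truncation c κ D u * (1 - winProb (perturbLaw (Fin K) 3) ((c / (κ * u)) • L) b) +
          K * (3 / 2 / truncation c κ D u ^ 2)) ≤
      D / 2 * (1 - winProb (perturbLaw (Fin K) 3) ((c / (κ * u)) • L) b) +
        residualCost c κ D u := by
  have := isProbabilityMeasure_perturbLaw (Fin K) (α := 3) three_pos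
  have hA := costConst_pos hc
  have hκ0 := one_pos.trans_le hκ
  have hη : 0 < c / (κ * u) := by positivity
  have hηκ : 6 * (c / (κ * u)) * κ ^ 2 ≤ 1 :=
    calc 6 * (c / (κ * u)) * κ ^ 2 = 6 * c * κ / u := by field_simp
      _ ≤ 1 := by
        rw [div_le_one hu]
        linarith [le_of_lateStart_le hc hκ hD h, mul_pos hA hκ0, mul_le_of_le_one_left hu.le hD1]
  have ha := one_le_truncation (u := u) hc hκ hD
  have hstab := stability_three_le hη.le hσ hℓ (sq_nonneg κ) (by rw [← hκK]; ring) hηκ ha b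
  have hx := sub_nonneg.2 (winProb_le_one (P := perturbLaw (Fin K) 3) ((c / (κ * u)) • L) b)
  generalize 1 - winProb (perturbLaw (Fin K) 3) ((c / (κ * u)) • L) b = x at *
  have := one_pos.trans_le ha
  have hax : 0 ≤ truncation c κ D u * x := by positivity
  have hK : 0 ≤ K / truncation c κ D u ^ 2 := by positivity
  calc _ ≤ costConst c * κ / u * (truncation c κ D u * x + K / truncation c κ D u ^ 2) :=
        cost_le hc hκ0 hu hstab hδ (by positivity) (by rw [mul_div_left_comm]; linarith)
    _ = D / 2 * x + residualCost c κ D u := by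
        rw [truncation, residualCost, if_neg h.not_gt, if_neg h.not_gt, ← hκK]
        field_simp
        ring

lemma stability_three_add_penalty_le (hc : 0 < c) (hκ : 1 ≤ κ) (hκK : κ ^ 6 = K) (hD : 0 < D)
    (hD1 : D ≤ 1) (hu : 0 < u) (hσ : IsRanking L σ) (hℓ : ∀ k, ℓ k ∈ Set.Icc (0 : ℝ) 1)
    (hδ : δ ≤ κ / c * (1 / u)) (b : Fin K) :
    stability 3 (c / (κ * u)) L σ ℓ +
        δ * (truncation c κ D u * (1 - winProb (perturbLaw (Fin K) 3) ((c / (κ * u)) • L) b) +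
          K * (3 / (3 - 1) * truncation c κ D u ^ (1 - 3 : ℝ))) ≤
      D / 2 * (1 - winProb (perturbLaw (Fin K) 3) ((c / (κ * u)) • L) b) +
        residualCost c κ D u := by
  have := isProbabilityMeasure_perturbLaw (Fin K) (α := 3) three_pos
  have hM := one_pos.trans_le (one_le_truncation (u := u) hc hκ hD)
  have htail : 3 / (3 - 1) * truncation c κ D u ^ (1 - 3 : ℝ) =
      3 / 2 / truncation c κ D u ^ 2 := by
    rw [show (1 - 3 : ℝ) = -(2 : ℕ) by norm_num, Real.rpow_neg hM.le, Real.rpow_natCast,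
      ← div_eq_mul_inv]
    norm_num
  rw [htail]
  obtain h | h := lt_or_ge u (lateStart c κ D)
  · exact cost_le_of_lt_lateStart hc (one_pos.trans_le hκ) hκK hD.le hu h hσ hℓ hδ
      ⟨sub_nonneg.2 (winProb_le_one _ _), sub_le_self _ (winProb_nonneg _ _)⟩
  · exact cost_le_of_lateStart_le hc hκ hκK hD hD1 hu h hσ hℓ hδ b

end Tuning

section RegretBound

lemma learningRate_three_eq (c : ℝ) (K t : ℕ) :
    learningRate 3 c K t = c / ((K : ℝ) ^ (1 / 6 : ℝ) * √((t : ℝ) + 1)) := by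
  rw [learningRate, show (1 / 3 - 1 / 2 : ℝ) = -(1 / 6) by norm_num,
    Real.rpow_neg (Nat.cast_nonneg K), ← div_eq_mul_inv, div_div]

variable {K : ℕ} [Nontrivial (Fin K)] {Ω : Type*} [m : MeasurableSpace Ω] {μ : Measure Ω}
  [IsProbabilityMeasure μ] {ℱ : Filtration ℕ m} {T : ℕ} {ℓ r : ℕ → Ω → Fin K → ℝ}
  {σ : ℕ → Ω → Equiv.Perm (Fin K)} {i j : ℕ → Ω → Fin K} {b : Fin K} {c D : ℝ}

lemma HasGap.pseudoRegret_three_le (hg : HasGap μ T ℱ ℓ b D) (hD : 0 < D) (hc : 0 < c)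
    (h : IsRun μ 3 (learningRate 3 c K) T ℱ ℓ r σ i j) :
    pseudoRegret μ T ℓ i ≤ regretConst c * (K / D) := by
  set κ : ℝ := (K : ℝ) ^ (1 / 6 : ℝ) with hκ_def
  have hκ : 1 ≤ κ := Real.one_le_rpow (Nat.one_le_cast.2 b.pos) (by norm_num)
  have hκ0 := one_pos.trans_le hκ
  have hκK : κ ^ 6 = K := by
    rw [hκ_def, ← Real.rpow_mul_natCast K.cast_nonneg]
    norm_num
  have hη : ∀ t, learningRate 3 c K t = c / (κ * √((t : ℝ) + 1)) := learningRate_three_eq c K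
  have hη0 : ∀ t, 0 < learningRate 3 c K t := fun t => by
    have := sqrt_succ_pos t
    rw [hη]
    positivity
  have hβη : ∀ t, κ / c * √((t + 1 : ℕ) : ℝ) = (learningRate 3 c K t)⁻¹ := fun t => by
    rw [hη, Nat.cast_succ, inv_div, mul_div_right_comm]
  have hβ : Monotone fun t : ℕ => κ / c * √(t : ℝ) := fun s t hst =>
    mul_le_mul_of_nonneg_left (Real.sqrt_le_sqrt (Nat.cast_le.2 hst)) (by positivity)
  have hδ : ∀ t : ℕ, κ / c * √((t + 1 : ℕ) : ℝ) - κ / c * √(t : ℝ) ≤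
      κ / c * (1 / √((t : ℝ) + 1)) := fun t => by
    rw [← mul_sub, Nat.cast_succ]
    exact mul_le_mul_of_nonneg_left (sqrt_succ_sub_sqrt_le t) (by positivity)
  rw [← hκK]
  refine (hg.pseudoRegret_le_two_mul_sum hD.le h (by norm_num) hη0 (by simp) hβη hβ
    (fun t => one_le_truncation (u := √((t : ℝ) + 1)) hc hκ hD) fun t ht ω => ?_).trans
    (two_mul_sum_residualCost_le hc hκ0 hD T)
  have hcost := stability_three_add_penalty_le hc hκ hκK hD (hg.le_one (Nat.zero_lt_of_lt ht))
    (sqrt_succ_pos t) (h.rank t ht ω) (hg.loss_mem t ht ω) (hδ t) b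
  rwa [← hη] at hcost

end RegretBound

end DecoupledBandit

end

theorem corollary1_general (c : ℝ) (hc : 0 < c) :
    ∃ C : ℝ, 0 < C ∧ ∀ (K : ℕ), 2 ≤ K → ∀ (T : ℕ)
      (Ω : Type*) [m : MeasurableSpace Ω] (μ : Measure Ω) [IsProbabilityMeasure μ]
      (ℱ : Filtration ℕ m) (ℓ r : ℕ → Ω → Fin K → ℝ) (σ : ℕ → Ω → Equiv.Perm (Fin K))
      (i j : ℕ → Ω → Fin K) (best : Fin K) (D : ℝ), 0 < D →
      DecoupledBandit.HasGap μ T ℱ ℓ best D →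
      DecoupledBandit.IsRun μ 3 (DecoupledBandit.learningRate 3 c K) T ℱ ℓ r σ i j →
      DecoupledBandit.pseudoRegret μ T ℓ i ≤ C * (K / D) := by
  refine ⟨DecoupledBandit.regretConst c, DecoupledBandit.regretConst_pos hc, ?_⟩
  intro K hK T Ω m μ _ ℱ ℓ r σ i j best D hD hg h
  have := Fin.nontrivial_iff_two_le.2 hK
  exact hg.pseudoRegret_three_le hD hc h

theorem corollary1 (c : ℝ) (hc : 0 < c) :
    ∃ C : ℝ, 0 < C ∧ ∀ (K : ℕ), 2 ≤ K → ∀ (T : ℕ)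
      (Ω : Type*) [m : MeasurableSpace Ω] (μ : Measure Ω) [IsProbabilityMeasure μ]
      (ℱ : Filtration ℕ m) (ℓ r : ℕ → Ω → Fin K → ℝ) (σ : ℕ → Ω → Equiv.Perm (Fin K))
      (i j : ℕ → Ω → Fin K) (Δ : Fin K → Fin K → ℝ) (best : Fin K),
      DecoupledBandit.IsSCA μ T ℱ ℓ Δ →
      (∀ k, k ≠ best → 0 < Δ k best) →
      DecoupledBandit.IsRun μ 3 (DecoupledBandit.learningRate 3 c K) T ℱ ℓ r σ i j →
      DecoupledBandit.pseudoRegret μ T ℓ i ≤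
        C * (√((K : ℝ) / DecoupledBandit.minGap Δ best *
              ∑ k ∈ Finset.univ.erase best, 1 / Δ k best)
            + (K : ℝ) / DecoupledBandit.minGap Δ best) := by
  obtain ⟨C, hC, hle⟩ := corollary1_general c hc
  refine ⟨C, hC, fun K hK T Ω m μ _ ℱ ℓ r σ i j Δ best hs hΔ h => ?_⟩
  have := Fin.nontrivial_iff_two_le.2 hK
  exact (hle K hK T Ω μ ℱ ℓ r σ i j best _ (DecoupledBandit.minGap_pos hΔ) (hs.hasGap best) h).trans
    (mul_le_mul_of_nonneg_left (le_add_of_nonneg_left (Real.sqrt_nonneg _)) hC.le)
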